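/- **Conventions.** Manifolds are smooth, finite dimensional, Hausdorff, second countable and without boundary. For a bivector field $\pi$ write $\pi^\sharp:T^*\Sigma\to T\Sigma$, $\langle\beta,\pi^\sharp\alpha\rangle=\pi(\alpha,\beta)$, $H_f=\pi^\sharp(df)$, $\{f,g\}=\pi(df,dg)$ and $\mathrm{Gr}(\pi)=\{\pi^\sharp\xi+\xi\}\subset T\Sigma\oplus T^*\Sigma$; $\pi$ is Poisson if $[\pi,\pi]=0$, and two Poisson structures commute if their Schouten bracket vanishes. A *Poisson submersion* $p:(\Sigma,\pi_\Sigma)\to(M,\pi_M)$ is a smooth submersion between Poisson manifolds with $p_*\pi_\Sigma=\pi_M$; put $V=\ker p_*\subset T\Sigma$ and let $V^\circ\subset T^*\Sigma$ be its annihilator. It is *coregular* if along each fibre $X=p^{-1}(m)$ the family $\pi_\Sigma^\sharp(N^*X)=\pi_\Sigma^\sharp(V^\circ)|_X$ is a smooth vector subbundle of $T\Sigma|_X$ with $\pi_\Sigma^\sharp(N^*X)\cap TX=0$. In that case each fibre $i:X\hookrightarrow\Sigma$ carries an induced Poisson structure $\pi_X$, determined by $\mathrm{Gr}(\pi_X)=\{u+i^*\xi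 : i_*u+\xi\in\mathrm{Gr}(\pi_\Sigma)\}$. Moreover the equivalence relation $$x_0\sim x_1\iff \exists f\in C_c^\infty(M\times[0,1]):\ \phi^{1,0}_{H_{f\circ p}}(x_0)=x_1$$ (where $\phi^{1,0}_{H_{f\circ p}}(x_0)$ is the time-one value of the integral curve of the time-dependent vector field $H_{f_t\circ p}$ on $\Sigma$ starting at $x_0$, required to exist on all of $[0,1]$) has as its classes the leaves of a singular foliation $\mathcal S_H$ with tangent spaces $\pi_\Sigma^\sharp(V^\circ)$, and each leaf carries the symplectic form $\omega(H_{f\circ p},H_{g\circ p})=\{f\circ p,g\circ p\}$. **Theorem.** Let $p:(\Sigma,\pi_\Sigma)\to(M,\pi_M)$ be a coregular Poisson submersion. The following are equivalent: 1. $p$ is an orthogonal pencil: $\pi_\Sigma=\pi_V+\pi_H$ for commuting Poisson structures $\pi_V,\pi_H$ on $\Sigma$, where $\pi_V\in\Gamma(\wedge^2V)$ is vertical and $\pi_H^\sharp(T^*\Sigma)\cap V=0$. 2. There is a Poisson structure $\pi_H$ on $\Sigma$ whose symplectic leaves (with their symplectic forms) are the leaves of $\mathcal S_H$ with the symplectic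 forms above. 3. The induced Poisson structures on the fibres assemble into a smooth vertical Poisson structure: there is a Poisson structure $\pi_V\in\Gamma(\wedge^2V)$ on $\Sigma$ that restricts on each fibre $X$ of $p$ to the induced Poisson structure $\pi_X$. 4. The linear family $\mathrm{Gr}(\pi_\Sigma)\cap(V\oplus T^*\Sigma)+V^\circ\subset T\Sigma\oplus T^*\Sigma$ is a smooth vector subbundle. -/

import Mathlib

open scoped Manifold ContDiff

/-! ## Cotangent spaces, smooth sections, subbundles

Manifolds are smooth, finite dimensional, without boundary, and modelled on a real normed
space `E`; the model with corners is always `𝓘(ℝ, E)`. -/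

/-- The cotangent space `T*_x M` of a manifold `M` modelled on `E`. -/
abbrev CotangentAt (E : Type*) [NormedAddCommGroup E] [NormedSpace ℝ E]
    {M : Type*} [TopologicalSpace M] [ChartedSpace E M] (x : M) : Type _ :=
  TangentSpace 𝓘(ℝ, E) x →L[ℝ] ℝ

/-- A family `D` of linear subspaces of the fibres of a smooth vector bundle `W` (with model fibre
`F`) over `M` is a smooth vector subbundle along the (embedded) submanifold `X ⊆ M` if around every
point of `X` it has a smooth local frame: finitely many smooth sections of `W`, which at all
nearby points of `X` form a basis of `D`. For `X = M` this is a vector subbundle of `W`. -/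
def IsSmoothSubbundleAlong (E : Type*) [NormedAddCommGroup E] [NormedSpace ℝ E]
    {M : Type*} [TopologicalSpace M] [ChartedSpace E M]
    (F : Type*) [NormedAddCommGroup F] [NormedSpace ℝ F]
    (W : M → Type*) [∀ x, AddCommGroup (W x)] [∀ x, Module ℝ (W x)]
    [∀ x, TopologicalSpace (W x)] [TopologicalSpace (Bundle.TotalSpace F W)] [FiberBundle F W]
    (X : Set M) (D : ∀ x, Submodule ℝ (W x)) : Prop :=
  ∀ x ∈ X, ∃ U : Set M, IsOpen U ∧ x ∈ U ∧ ∃ (k : ℕ) (s : Fin k → ∀ y, W y),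
    (∀ i, ContMDiffOn 𝓘(ℝ, E) (𝓘(ℝ, E).prod 𝓘(ℝ, F)) ∞
      (fun y => Bundle.TotalSpace.mk' F y (s i y)) U) ∧
    ∀ y ∈ U ∩ X, LinearIndependent ℝ (fun i => s i y) ∧
      Submodule.span ℝ (Set.range fun i => s i y) = D y

/-! ## Bivector fields and Poisson structures -/

/-- A smooth bivector field `π` on `M`, given by the bundle map `π♯ : T*M → TM`,
`β (π♯ α) = π(α, β)`. -/
structure BivectorField (E : Type*) [NormedAddCommGroup E] [NormedSpace ℝ E]
    (M : Type*) [TopologicalSpace M] [ChartedSpace E M] [IsManifold 𝓘(ℝ, E) ∞ M] where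
  sharp : ∀ x : M, CotangentAt E x →L[ℝ] TangentSpace 𝓘(ℝ, E) x
  skew : ∀ (x : M) (α β : CotangentAt E x), β (sharp x α) = - α (sharp x β)
  smooth : ContMDiff 𝓘(ℝ, E) (𝓘(ℝ, E).prod 𝓘(ℝ, (E →L[ℝ] ℝ) →L[ℝ] E)) ∞
    (fun x => Bundle.TotalSpace.mk' ((E →L[ℝ] ℝ) →L[ℝ] E)
      (E := fun y : M => CotangentAt E y →L[ℝ] TangentSpace 𝓘(ℝ, E) y) x (sharp x))

namespace BivectorField

variable {E : Type*} [NormedAddCommGroup E] [NormedSpace ℝ E]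
  {M : Type*} [TopologicalSpace M] [ChartedSpace E M] [IsManifold 𝓘(ℝ, E) ∞ M]

/-- The Hamiltonian vector field `H_f = π♯(df)`. -/
noncomputable def hamiltonian (π : BivectorField E M) (f : M → ℝ) (x : M) :
    TangentSpace 𝓘(ℝ, E) x :=
  π.sharp x (mvfderiv 𝓘(ℝ, E) f x)

/-- The bracket `{f, g} = π(df, dg)`. -/
noncomputable def bracket (π : BivectorField E M) (f g : M → ℝ) (x : M) : ℝ :=
  mvfderiv 𝓘(ℝ, E) g x (π.hamiltonian f x)

/-- The Schouten bracket `[π, σ]` of two bivector fields, evaluated on `(df, dg, dh)`: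
the cyclic sum of `{{f, g}_π, h}_σ + {{f, g}_σ, h}_π`. -/
noncomputable def schouten (π σ : BivectorField E M) (f g h : M → ℝ) (x : M) : ℝ :=
  (σ.bracket (π.bracket f g) h x + π.bracket (σ.bracket f g) h x) +
  (σ.bracket (π.bracket g h) f x + π.bracket (σ.bracket g h) f x) +
  (σ.bracket (π.bracket h f) g x + π.bracket (σ.bracket h f) g x)

/-- `π` and `σ` commute: the trivector field `[π, σ]` vanishes, that is, it vanishes on all
differentials of smooth functions. -/
def Commute (π σ : BivectorField E M) : Prop :=
  ∀ f g h : M → ℝ, ContMDiff 𝓘(ℝ, E) 𝓘(ℝ, ℝ) ∞ f → ContMDiff 𝓘(ℝ, E) 𝓘(ℝ, ℝ) ∞ g →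
    ContMDiff 𝓘(ℝ, E) 𝓘(ℝ, ℝ) ∞ h → ∀ x, schouten π σ f g h x = 0

/-- `π` is a Poisson structure: `[π, π] = 0`. Since `schouten π π f g h` is twice the Jacobiator,
this is the Jacobi identity for the bracket of `π`. -/
def IsPoisson (π : BivectorField E M) : Prop := π.Commute π

/-- The characteristic subspace `π♯(T*_x M)`: the tangent space at `x` of the symplectic leaf
through `x` when `π` is Poisson. -/
noncomputable def image (π : BivectorField E M) (x : M) : Submodule ℝ (TangentSpace 𝓘(ℝ, E) x) :=
  LinearMap.range (π.sharp x).toLinearMap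

/-- The graph `Gr(π) = {π♯(ξ) + ξ} ⊆ TM ⊕ T*M`. -/
noncomputable def graph (π : BivectorField E M) (x : M) :
    Submodule ℝ (TangentSpace 𝓘(ℝ, E) x × CotangentAt E x) :=
  LinearMap.range ((π.sharp x).toLinearMap.prod LinearMap.id)

open Classical in
/-- The symplectic form `ω` on the characteristic subspace `π♯(T*_x M)`, the one with
`ω(π♯ α, π♯ β) = π(α, β)`, equivalently `ω(H_f, H_g) = {f, g}`. Only its values on the
characteristic subspace are meaningful. -/
noncomputable def leafForm (π : BivectorField E M) (x : M) (u v : TangentSpace 𝓘(ℝ, E) x) : ℝ :=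
  if h : ∃ β : CotangentAt E x, π.sharp x β = v then h.choose u else 0

theorem leafForm_sharp (π : BivectorField E M) (x : M) (α β : CotangentAt E x) :
    π.leafForm x (π.sharp x α) (π.sharp x β) = β (π.sharp x α) := by
  have h : ∃ β' : CotangentAt E x, π.sharp x β' = π.sharp x β := ⟨β, rfl⟩
  rw [leafForm, dif_pos h, π.skew, h.choose_spec, ← π.skew]

/-- The Hamiltonian orbit of `x₀` for the functions pulled back along `q : M → N`: the points
`x₁ = φ^{1,0}_{H_{f ∘ q}}(x₀)`, where `f` runs over the compactly supported smooth time-dependent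
functions on `N` (`f ∈ C_c^∞(N × [0, 1])`, written as the restriction of a compactly supported
smooth function on `N × ℝ`). The flow of `H_{f ∘ q}` need not be complete: `x₁` is the end point of
an integral curve defined on all of `[0, 1]`. -/
def hamiltonianOrbit (π : BivectorField E M)
    (F : Type*) [NormedAddCommGroup F] [NormedSpace ℝ F]
    {N : Type*} [TopologicalSpace N] [ChartedSpace F N] (q : M → N) (x₀ : M) : Set M :=
  {x₁ | ∃ f : N × ℝ → ℝ,
    ContMDiff (𝓘(ℝ, F).prod 𝓘(ℝ, ℝ)) 𝓘(ℝ, ℝ) ∞ f ∧ HasCompactSupport f ∧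
    ∃ γ : ℝ → M, γ 0 = x₀ ∧ γ 1 = x₁ ∧
      ∀ t ∈ Set.Icc (0 : ℝ) 1,
        HasMFDerivWithinAt 𝓘(ℝ, ℝ) 𝓘(ℝ, E) γ (Set.Icc 0 1) t
          ((1 : ℝ →L[ℝ] ℝ).smulRight (π.hamiltonian (fun y => f (q y, t)) (γ t)))}

/-- The symplectic leaf through `x` of a Poisson structure, as a subset of `M`: the points reached
from `x` along Hamiltonian flows of (time-dependent) functions on `M`. -/
def leaf (π : BivectorField E M) (x : M) : Set M := π.hamiltonianOrbit E id x

end BivectorField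

/-! ## Poisson submersions -/

section Submersion

variable {E : Type*} [NormedAddCommGroup E] [NormedSpace ℝ E]
  {S : Type*} [TopologicalSpace S] [ChartedSpace E S]
  {F : Type*} [NormedAddCommGroup F] [NormedSpace ℝ F]
  {M : Type*} [TopologicalSpace M] [ChartedSpace F M]

/-- The vertical space `V_x = ker (d_x p)`, the tangent space at `x` of the fibre through `x`. -/
noncomputable def verticalSpace (E F : Type*) [NormedAddCommGroup E] [NormedSpace ℝ E]
    {S : Type*} [TopologicalSpace S] [ChartedSpace E S]
    [NormedAddCommGroup F] [NormedSpace ℝ F]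
    {M : Type*} [TopologicalSpace M] [ChartedSpace F M] (p : S → M) (x : S) :
    Submodule ℝ (TangentSpace 𝓘(ℝ, E) x) :=
  LinearMap.ker (mfderiv 𝓘(ℝ, E) 𝓘(ℝ, F) p x).toLinearMap

/-- The annihilator `V°_x ⊆ T*_x S` of the vertical space, the conormal space at `x` of the fibre
through `x`. -/
noncomputable def verticalAnnihilator (E F : Type*) [NormedAddCommGroup E] [NormedSpace ℝ E]
    {S : Type*} [TopologicalSpace S] [ChartedSpace E S]
    [NormedAddCommGroup F] [NormedSpace ℝ F]
    {M : Type*} [TopologicalSpace M] [ChartedSpace F M] (p : S → M) (x : S) :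
    Submodule ℝ (CotangentAt E x) where
  carrier := {ξ | ∀ v ∈ verticalSpace E F p x, ξ v = 0}
  add_mem' := by
    intro a b ha hb v hv
    simp [ha v hv, hb v hv]
  zero_mem' := by
    intro v _
    simp
  smul_mem' := by
    intro c a ha v hv
    simp [ha v hv]

variable [IsManifold 𝓘(ℝ, E) ∞ S] [IsManifold 𝓘(ℝ, F) ∞ M]

/-- `p : (S, πS) → (M, πM)` is a Poisson submersion: a smooth submersion with `p_* πS = πM`,
that is `d_x p ∘ πS♯ ∘ (d_x p)* = πM♯` for all `x`. -/
structure IsPoissonSubmersion (πS : BivectorField E S) (πM : BivectorField F M) (p : S → M) :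
    Prop where
  smooth : ContMDiff 𝓘(ℝ, E) 𝓘(ℝ, F) ∞ p
  submersion : ∀ x, Function.Surjective (mfderiv 𝓘(ℝ, E) 𝓘(ℝ, F) p x)
  poisson : ∀ (x : S) (α : CotangentAt F (p x)),
    mfderiv 𝓘(ℝ, E) 𝓘(ℝ, F) p x (πS.sharp x (α.comp (mfderiv 𝓘(ℝ, E) 𝓘(ℝ, F) p x))) =
      πM.sharp (p x) α

/-- The horizontal subspace `πS♯(V°)`, the tangent space at `x` of the horizontal leaf. -/
noncomputable def horizontalSpace (F : Type*) [NormedAddCommGroup F] [NormedSpace ℝ F]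
    {M : Type*} [TopologicalSpace M] [ChartedSpace F M]
    (πS : BivectorField E S) (p : S → M) (x : S) : Submodule ℝ (TangentSpace 𝓘(ℝ, E) x) :=
  (verticalAnnihilator E F p x).map (πS.sharp x).toLinearMap

/-- All fibres `X = p⁻¹(m)` are coregular submanifolds of `(S, πS)`: `πS♯(N*X) ⊆ TS|_X` is a smooth
vector subbundle (along `X`) which meets `TX` trivially. -/
def HasCoregularFibres (F : Type*) [NormedAddCommGroup F] [NormedSpace ℝ F]
    {M : Type*} [TopologicalSpace M] [ChartedSpace F M]
    (πS : BivectorField E S) (p : S → M) : Prop :=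
  ∀ m : M,
    IsSmoothSubbundleAlong E E (TangentSpace 𝓘(ℝ, E) : S → Type _) (p ⁻¹' {m})
      (horizontalSpace F πS p) ∧
    ∀ x ∈ p ⁻¹' {m}, horizontalSpace F πS p x ⊓ verticalSpace E F p x = ⊥

/-- The bivector field `π` is vertical, `π ∈ Γ(∧² V)`: its sharp map takes values in `V`. -/
def IsVertical (F : Type*) [NormedAddCommGroup F] [NormedSpace ℝ F]
    {M : Type*} [TopologicalSpace M] [ChartedSpace F M]
    (π : BivectorField E S) (p : S → M) : Prop :=
  ∀ x, π.image x ≤ verticalSpace E F p x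

/-- `πS` splits as `πV + πH` into commuting Poisson structures, with `πV` vertical and
`πH♯(T*S) ∩ V = 0`. -/
def IsOrthogonalPencil (F : Type*) [NormedAddCommGroup F] [NormedSpace ℝ F]
    {M : Type*} [TopologicalSpace M] [ChartedSpace F M]
    (πS : BivectorField E S) (p : S → M) : Prop :=
  ∃ πV πH : BivectorField E S, πV.IsPoisson ∧ πH.IsPoisson ∧ πV.Commute πH ∧
    (∀ x, πS.sharp x = πV.sharp x + πH.sharp x) ∧
    IsVertical F πV p ∧ ∀ x, πH.image x ⊓ verticalSpace E F p x = ⊥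

/-- The leaf through `x` of the singular horizontal foliation: the points `φ^{1,0}_{H_{f ∘ p}}(x)`,
`f ∈ C_c^∞(M × [0, 1])`. -/
def horizontalLeaf (F : Type*) [NormedAddCommGroup F] [NormedSpace ℝ F]
    {M : Type*} [TopologicalSpace M] [ChartedSpace F M]
    (πS : BivectorField E S) (p : S → M) (x : S) : Set S :=
  πS.hamiltonianOrbit F p x

/-- The symplectic leaves of `πH` are the leaves of the singular horizontal foliation, the latter
with the symplectic forms `ω(H_{f ∘ p}, H_{g ∘ p}) = {f ∘ p, g ∘ p}`, that is, the restrictions to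
`πS♯(V°)` of the leafwise symplectic forms of `πS`: the leaves, their tangent spaces and their
symplectic forms agree. -/
def HasHorizontalLeaves (F : Type*) [NormedAddCommGroup F] [NormedSpace ℝ F]
    {M : Type*} [TopologicalSpace M] [ChartedSpace F M]
    (πS : BivectorField E S) (p : S → M) (πH : BivectorField E S) : Prop :=
  ∀ x, πH.leaf x = horizontalLeaf F πS p x ∧
    πH.image x = horizontalSpace F πS p x ∧
    ∀ u ∈ horizontalSpace F πS p x, ∀ v ∈ horizontalSpace F πS p x,
      πH.leafForm x u v = πS.leafForm x u v

/-- `ρ : T*_x X → T_x X` is the Poisson structure at `x` induced by `πS` on the fibre `X` of `p`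
through `x`, with inclusion `i : X → S`:
`Gr(ρ) = i^! Gr(πS) = {u + i*(ξ) | i_*(u) + ξ ∈ Gr(πS)}`. -/
def IsInducedOnFibre (πS : BivectorField E S) (p : S → M) (x : S)
    (ρ : (verticalSpace E F p x →L[ℝ] ℝ) →L[ℝ] verticalSpace E F p x) : Prop :=
  ∀ (u : verticalSpace E F p x) (η : verticalSpace E F p x →L[ℝ] ℝ),
    u = ρ η ↔ ∃ ξ : CotangentAt E x,
      η = ξ.comp (verticalSpace E F p x).subtypeL ∧
        ((u : TangentSpace 𝓘(ℝ, E) x), ξ) ∈ πS.graph x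

/-- The induced Poisson structures on the fibres assemble into the bivector field `πV`, that is,
at every `x` the value of `πV` is the pushforward `i_* ρ` of the Poisson structure `ρ` induced on
the fibre through `x`, where `i` is the inclusion of the fibre. -/
def FibrePoissonAssembleTo (F : Type*) [NormedAddCommGroup F] [NormedSpace ℝ F]
    {M : Type*} [TopologicalSpace M] [ChartedSpace F M]
    (πS : BivectorField E S) (p : S → M) (πV : BivectorField E S) : Prop :=
  ∀ x, ∃ ρ : (verticalSpace E F p x →L[ℝ] ℝ) →L[ℝ] verticalSpace E F p x,
    IsInducedOnFibre πS p x ρ ∧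
    ∀ ξ : CotangentAt E x,
      πV.sharp x ξ =
        (ρ (ξ.comp (verticalSpace E F p x).subtypeL) : TangentSpace 𝓘(ℝ, E) x)

/-- The linear family `Gr(πS) ∩ (V ⊕ T*S) + V° ⊆ TS ⊕ T*S`. -/
noncomputable def verticalDiracFamily (F : Type*) [NormedAddCommGroup F] [NormedSpace ℝ F]
    {M : Type*} [TopologicalSpace M] [ChartedSpace F M]
    (πS : BivectorField E S) (p : S → M) (x : S) :
    Submodule ℝ (TangentSpace 𝓘(ℝ, E) x × CotangentAt E x) :=
  (πS.graph x ⊓ (verticalSpace E F p x).prod ⊤) ⊔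
    (⊥ : Submodule ℝ (TangentSpace 𝓘(ℝ, E) x)).prod (verticalAnnihilator E F p x)

/-- `Gr(πS) ∩ (V ⊕ T*S) + V°` is a smooth vector subbundle of `TS ⊕ T*S`. -/
def VerticalDiracFamilyIsBundle (F : Type*) [NormedAddCommGroup F] [NormedSpace ℝ F]
    {M : Type*} [TopologicalSpace M] [ChartedSpace F M]
    (πS : BivectorField E S) (p : S → M) : Prop :=
  IsSmoothSubbundleAlong E (E × (E →L[ℝ] ℝ))
    (fun x : S => TangentSpace 𝓘(ℝ, E) x × CotangentAt E x) Set.univ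
    (verticalDiracFamily F πS p)

end Submersion

/-! ## Linear maps of constant rank -/

/-! All four conditions are compared with a single one: the pointwise vertical part of `πS` is
smooth (`IsVerticalPartField`).

At a point let `A` be the map `πS♯`. By skewness `A⁻¹(V)` is the annihilator of `A(V°)`, so
coregularity, `A(V°) ∩ V = 0`, dualizes to `T* = A⁻¹(V) + V°`, and it also makes `A` vanish on
`A⁻¹(V) ∩ V°`. Hence there is exactly one map `B` that equals `A` on `A⁻¹(V)` and is zero on `V°`.
It is skew with values in `V`, and `A - B` has range `A(V°)`. The vertical summand of an orthogonal
pencil is `B`; a bivector with the tangent spaces and forms of the horizontal leaves is `A - B`; the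
fibrewise Poisson structures push forward to `B`; the Dirac family is the graph of `B`, hence a
subbundle exactly when `B` is smooth.

Once `B` is a smooth field `πV`, the Poisson identities for `πV` and `πH = πS - πV` are automatic.
The Schouten trivectors are tested on covectors from `ker πH♯` and `V°`, which together span. Two
entries in `V°` are differentials of functions pulled back from the base; their `πH`-brackets are
`πS`-brackets, and their mutual bracket is again pulled back, so Jacobi for `πS` applies. Two
entries in `ker πH♯` are handled where the rank of `πH` is locally maximal, since the derivative of
`πH` then vanishes on its kernel (`fderiv_apply_ker_eq_zero_of_rank_le`). Such points are dense, and
continuity does the rest. Polarizing `[πS, πS] = 0` gives `[πV, πH] = 0`.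

For the leaves, a Hamiltonian curve of `πH` has to be driven by functions from the base. The rank of
`πH` does not increase near any time along such a curve (`eventually_rank_le_along_hamiltonian`), so
its velocity lifts smoothly to pulled-back covectors locally in time (`exists_local_hamiltonian`); a
partition of unity in time glues the lifts. -/

open Module in
theorem LinearMap.exists_generalized_inverse {X Y : Type*} [AddCommGroup X] [Module ℝ X]
    [AddCommGroup Y] [Module ℝ Y] (C : X →ₗ[ℝ] Y) :
    ∃ G : Y →ₗ[ℝ] X, ∀ x, C (G (C x)) = C x := by
  obtain ⟨s, hs⟩ := C.rangeRestrict.exists_rightInverse_of_surjective C.range_rangeRestrict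
  obtain ⟨G, hG⟩ := s.exists_extend
  refine ⟨G, fun x => ?_⟩
  have h1 : G (C x) = s ⟨C x, x, rfl⟩ := by rw [← hG]; rfl
  have h2 := congrArg Subtype.val (LinearMap.congr_fun hs ⟨C x, x, rfl⟩)
  rw [h1]
  exact h2

open Module in
/-- Let `C₀ G C₀ = C₀` and `M = 1 + (C - C₀) G` with left inverse `N`. If the range of `C` is contained
in `R` and `dim R ≤ rank C₀`, then `G N` is a right inverse of `C` on `R`. -/
theorem LinearMap.rightInverse_of_finrank_le {X Y : Type*} [AddCommGroup X] [Module ℝ X]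
    [AddCommGroup Y] [Module ℝ Y] [FiniteDimensional ℝ Y] (C₀ C : X →ₗ[ℝ] Y) (G : Y →ₗ[ℝ] X)
    (hG : ∀ x, C₀ (G (C₀ x)) = C₀ x) (N : Y →ₗ[ℝ] Y)
    (hN : ∀ y, N (y + (C (G y) - C₀ (G y))) = y) (R : Submodule ℝ Y)
    (hR : LinearMap.range C ≤ R) (hr : finrank ℝ R ≤ finrank ℝ (LinearMap.range C₀))
    (u : Y) (hu : u ∈ R) : C (G (N u)) = u ∧ N u ∈ LinearMap.range C₀ := by
  set M : Y →ₗ[ℝ] Y := LinearMap.id + (C - C₀) ∘ₗ G with hM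
  have hMinj : Function.Injective M :=
    Function.LeftInverse.injective (g := N) fun y => by simpa [hM] using hN y
  -- `M` carries `range C₀` into `range C ≤ R`; being injective, it fills `R` by the dimension
  -- bound.
  have hMC : ∀ x, M (C₀ x) = C (G (C₀ x)) := fun x => by simp [hM, hG]
  have hle : (LinearMap.range C₀).map M ≤ R := by
    rintro _ ⟨_, ⟨x, rfl⟩, rfl⟩
    rw [hMC]
    exact hR ⟨_, rfl⟩
  have heq : (LinearMap.range C₀).map M = R := by
    apply Submodule.eq_of_le_of_finrank_le hle
    rw [← ((LinearMap.range C₀).equivMapOfInjective M hMinj).finrank_eq]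
    exact hr
  rw [← heq] at hu
  obtain ⟨_, ⟨x, rfl⟩, rfl⟩ := hu
  have hNM : N (M (C₀ x)) = C₀ x := by simpa [hM] using hN (C₀ x)
  exact ⟨by rw [hNM, hMC], by rw [hNM]; exact ⟨x, rfl⟩⟩

section Calculus

variable {E : Type*} [NormedAddCommGroup E] [NormedSpace ℝ E]

/-- The left inverse of `1 + (C z - C z₀) G` for `z` near `z₀`. -/
theorem exists_leftInverse_near {X : Type*} [NormedAddCommGroup X] [NormedSpace ℝ X]
    {Y : Type*} [NormedAddCommGroup Y] [NormedSpace ℝ Y] [CompleteSpace Y]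
    {Z : Type*} [NormedAddCommGroup Z] [NormedSpace ℝ Z] {n : WithTop ℕ∞}
    (C : Z → X →L[ℝ] Y) (z₀ : Z) (hC : ∀ᶠ z in nhds z₀, ContDiffAt ℝ n C z) (G : Y →L[ℝ] X) :
    ∃ N : Z → Y →L[ℝ] Y, (∀ᶠ z in nhds z₀, ContDiffAt ℝ n N z) ∧
      N z₀ = ContinuousLinearMap.id ℝ Y ∧
      ∀ᶠ z in nhds z₀, ∀ y, N z (y + (C z (G y) - C z₀ (G y))) = y := by
  set M : Z → Y →L[ℝ] Y := fun z => ContinuousLinearMap.id ℝ Y + (C z - C z₀).comp G with hM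
  have hMd : ∀ᶠ z in nhds z₀, ContDiffAt ℝ n M z := hC.mono fun z hz =>
    contDiffAt_const.add ((hz.sub contDiffAt_const).clm_comp contDiffAt_const)
  have hM0 : M z₀ = ContinuousLinearMap.id ℝ Y := by simp [hM]
  have hM1 : M z₀ = ((ContinuousLinearEquiv.refl ℝ Y : Y ≃L[ℝ] Y) : Y →L[ℝ] Y) := by
    rw [hM0]; rfl
  have hc : ContinuousAt M z₀ := hMd.self_of_nhds.continuousAt
  have hopen := ContinuousLinearEquiv.nhds (ContinuousLinearEquiv.refl ℝ Y)
  rw [← hM1] at hopen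
  refine ⟨fun z => (M z).inverse, ?_, ?_, ?_⟩
  · filter_upwards [hMd, hc hopen] with z hz hz'
    obtain ⟨e, he⟩ := hz'
    have := contDiffAt_map_inverse (𝕜 := ℝ) (n := n) e
    rw [he] at this
    exact this.comp z hz
  · simp [hM0]
  · filter_upwards [hc hopen] with z hz y
    obtain ⟨e, he⟩ := hz
    have h : M z y = y + (C z (G y) - C z₀ (G y)) := by simp [hM]
    rw [← h, ← he, ContinuousLinearMap.inverse_equiv]
    simp

open Module in
/-- The derivative of a family of skew maps of locally maximal rank vanishes on the kernel. -/
theorem fderiv_apply_ker_eq_zero_of_rank_le [FiniteDimensional ℝ E]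
    (A : E → (E →L[ℝ] ℝ) →L[ℝ] E) (z₀ : E) (hA : ContDiffAt ℝ 1 A z₀)
    (hskew : ∀ α β : E →L[ℝ] ℝ, β (A z₀ α) = - α (A z₀ β))
    (hrank : ∀ᶠ z in nhds z₀, finrank ℝ (LinearMap.range (A z).toLinearMap) ≤
      finrank ℝ (LinearMap.range (A z₀).toLinearMap))
    (v : E) (α β : E →L[ℝ] ℝ) (hα : A z₀ α = 0) (hβ : A z₀ β = 0) :
    β (fderiv ℝ A z₀ v α) = 0 := by
  have : CompleteSpace E := FiniteDimensional.complete ℝ E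
  obtain ⟨G', hG'⟩ := (A z₀).toLinearMap.exists_generalized_inverse
  set G : E →L[ℝ] (E →L[ℝ] ℝ) := LinearMap.toContinuousLinearMap G' with hG
  obtain ⟨N, hN, hN0, hNM⟩ := exists_leftInverse_near A z₀ (hA.eventually (by simp)) G
  -- `N z` moves the range of `A z` into that of `A z₀`, which `β` annihilates by skewness. In the
  -- derivative at `z₀` the term from `N` drops out because `A z₀ α = 0`, and `N z₀ = 1` leaves the
  -- claim.
  have hz : (fun z => β (N z (A z α))) =ᶠ[nhds z₀] fun _ => 0 := by
    filter_upwards [hrank, hNM] with z hz hNz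
    obtain ⟨-, w, hw⟩ := LinearMap.rightInverse_of_finrank_le (A z₀).toLinearMap (A z).toLinearMap G'
      hG' (N z).toLinearMap hNz _ le_rfl hz (A z α) ⟨α, rfl⟩
    have hw' : A z₀ w = N z (A z α) := hw
    rw [← hw', hskew, hβ, map_zero, neg_zero]
  have hAd := (hA.differentiableAt one_ne_zero).hasFDerivAt
  have hNd := (hN.self_of_nhds.differentiableAt one_ne_zero).hasFDerivAt
  have h1 := (hNd.clm_apply (hAd.clm_apply (hasFDerivAt_const α z₀)))
  have h2 := β.hasFDerivAt.comp z₀ h1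
  have h3 := h2.unique ((hasFDerivAt_const (0 : ℝ) z₀).congr_of_eventuallyEq hz)
  simpa [hN0, hα] using congrArg (fun L => L v) h3

/-! ## Linear differential equations preserving the rank -/

theorem ContinuousLinearMap.hasDerivAt_apply {V W : Type*} [NormedAddCommGroup V] [NormedSpace ℝ V]
    [NormedAddCommGroup W] [NormedSpace ℝ W] (D : V →L[ℝ] W) {f : ℝ → V} {f' : V} {t : ℝ}
    (h : HasDerivAt f f' t) : HasDerivAt (fun t => D (f t)) (D f') t :=
  HasFDerivAt.comp_hasDerivAt t (D.hasFDerivAt (x := f t)) h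

/-- Time is added as a coordinate with velocity 1, which makes the system autonomous; that
coordinate then has to be identified with `t`. -/
theorem exists_fundamentalSolution [CompleteSpace E] (N : ℝ → E →L[ℝ] E) (t₀ : ℝ)
    (hN : ContDiffAt ℝ 1 N t₀) :
    ∃ Φ : ℝ → E →L[ℝ] E, Φ t₀ = ContinuousLinearMap.id ℝ E ∧
      ∀ᶠ t in nhds t₀, HasDerivAt Φ ((N t).comp (Φ t)) t := by
  have hX : ContDiffAt ℝ 1 (fun q : ℝ × (E →L[ℝ] E) => ((1 : ℝ), (N q.1).comp q.2))
      (t₀, ContinuousLinearMap.id ℝ E) := by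
    refine contDiffAt_const.prodMk (ContDiffAt.clm_comp ?_ contDiffAt_snd)
    exact ContDiffAt.comp (t₀, ContinuousLinearMap.id ℝ E) hN contDiffAt_fst
  obtain ⟨q, hq0, ε, hε, hq⟩ :=
    ContDiffAt.exists_forall_mem_closedBall_exists_eq_forall_mem_Ioo_hasDerivAt₀ hX t₀
  have hmem : Set.Ioo (t₀ - ε) (t₀ + ε) ∈ nhds t₀ :=
    Ioo_mem_nhds (by linarith) (by linarith)
  have hq1 : ∀ t ∈ Set.Ioo (t₀ - ε) (t₀ + ε), (q t).1 = t := by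
    have h1 : ∀ t ∈ Set.Ioo (t₀ - ε) (t₀ + ε), HasDerivAt (fun t => (q t).1 - t) 0 t := by
      intro t ht
      have h := (hasFDerivAt_fst (𝕜 := ℝ) (p := q t)).comp_hasDerivAt t (hq t ht)
      have h' := h.sub (hasDerivAt_id t)
      simp only [ContinuousLinearMap.coe_fst', sub_self] at h'
      exact h'
    intro t ht
    have h2 := (convex_Ioo (t₀ - ε) (t₀ + ε)).is_const_of_fderivWithin_eq_zero (𝕜 := ℝ)
      (f := fun t => (q t).1 - t)
      (fun s hs => (h1 s hs).differentiableAt.differentiableWithinAt) (fun s hs => by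
        rw [fderivWithin_of_isOpen isOpen_Ioo hs]
        ext
        simpa using (h1 s hs).deriv) ht (mem_of_mem_nhds hmem)
    simpa [hq0, sub_eq_zero] using h2
  refine ⟨fun t => (q t).2, by simp [hq0], ?_⟩
  filter_upwards [hmem] with t ht
  have h := (hasFDerivAt_snd (𝕜 := ℝ) (p := q t)).comp_hasDerivAt t (hq t ht)
  simp only [ContinuousLinearMap.coe_snd', hq1 t ht] at h
  exact h

/-- Precomposition with an endomorphism. -/
noncomputable def precompDual (E : Type*) [NormedAddCommGroup E] [NormedSpace ℝ E] :
    (E →L[ℝ] E) →L[ℝ] (E →L[ℝ] ℝ) →L[ℝ] (E →L[ℝ] ℝ) :=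
  (ContinuousLinearMap.compL ℝ E E ℝ).flip

theorem precompDual_apply (L : E →L[ℝ] E) (α : E →L[ℝ] ℝ) : precompDual E L α = α.comp L := rfl

theorem norm_precompDual_le (L : E →L[ℝ] E) : ‖precompDual E L‖ ≤ ‖L‖ :=
  ContinuousLinearMap.opNorm_le_bound _ (norm_nonneg _) fun α => by
    rw [mul_comm]
    exact α.opNorm_comp_le L

theorem lipschitzWith_comp_add_comp (N : E →L[ℝ] E) (c : NNReal) (hN : ‖N‖ ≤ c) :
    LipschitzWith (2 * c) (fun Z : (E →L[ℝ] ℝ) →L[ℝ] E => N.comp Z + Z.comp (precompDual E N)) := by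
  apply LipschitzWith.of_dist_le_mul
  intro Z W
  rw [dist_eq_norm, dist_eq_norm]
  have : N.comp Z + Z.comp (precompDual E N) - (N.comp W + W.comp (precompDual E N)) =
      N.comp (Z - W) + (Z - W).comp (precompDual E N) := by ext; simp; abel
  rw [this]
  have h1 := N.opNorm_comp_le (Z - W)
  have h2 := (Z - W).opNorm_comp_le (precompDual E N)
  have h3 := norm_precompDual_le N
  have h4 := norm_add_le (N.comp (Z - W)) ((Z - W).comp (precompDual E N))
  have h5 : ‖Z - W‖ * ‖precompDual E N‖ ≤ ‖Z - W‖ * c := by gcongr; exact h3.trans hN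
  have h6 : ‖N‖ * ‖Z - W‖ ≤ c * ‖Z - W‖ := by gcongr
  push_cast
  nlinarith

open Module in
-- With `Φ` the fundamental solution of `N`, the curve `Φ ∘ B t₀ ∘ Φ*` solves the same linear
-- equation with the same initial value. By uniqueness it is `B`, and composition cannot raise the
-- rank.
theorem eventually_rank_le_of_hasDerivAt [FiniteDimensional ℝ E]
    (B : ℝ → (E →L[ℝ] ℝ) →L[ℝ] E) (N : ℝ → E →L[ℝ] E) (t₀ : ℝ) (hN : ContDiffAt ℝ 1 N t₀)
    (hB : ∀ᶠ t in nhds t₀, HasDerivAt B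
      ((N t).comp (B t) + (B t).comp (precompDual E (N t))) t) :
    ∀ᶠ t in nhds t₀, finrank ℝ (LinearMap.range (B t).toLinearMap) ≤
      finrank ℝ (LinearMap.range (B t₀).toLinearMap) := by
  have : CompleteSpace E := FiniteDimensional.complete ℝ E
  obtain ⟨Φ, hΦ0, hΦd⟩ := exists_fundamentalSolution N t₀ hN
  set Y : ℝ → (E →L[ℝ] ℝ) →L[ℝ] E :=
    fun t => (Φ t).comp ((B t₀).comp (precompDual E (Φ t))) with hY
  have hYd : ∀ᶠ t in nhds t₀,
      HasDerivAt Y ((N t).comp (Y t) + (Y t).comp (precompDual E (N t))) t := by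
    filter_upwards [hΦd] with t ht
    have h1 := ContinuousLinearMap.hasDerivAt_apply
      (W := (E →L[ℝ] ℝ) →L[ℝ] (E →L[ℝ] ℝ)) (precompDual E) ht
    have h2 := ht.clm_comp ((hasDerivAt_const t (B t₀)).clm_comp h1)
    convert h2 using 1
    ext α
    simp [hY, precompDual_apply, ContinuousLinearMap.comp_assoc]
  have hNb : ∀ᶠ t in nhds t₀, ‖N t‖ < ‖N t₀‖ + 1 :=
    hN.continuousAt.norm.eventually_lt_const (lt_add_one _)
  have hu := ODE_solution_unique_of_eventually (t₀ := t₀) (f := B) (g := Y)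
    (v := fun t Z => (N t).comp Z + Z.comp (precompDual E (N t))) (s := fun _ => Set.univ)
    (K := 2 * (‖N t₀‖₊ + 1))
    (hNb.mono fun t ht => (lipschitzWith_comp_add_comp (N t) (‖N t₀‖₊ + 1)
      (by push_cast; exact ht.le)).lipschitzOnWith)
    (hB.mono fun t ht => ⟨ht, Set.mem_univ _⟩) (hYd.mono fun t ht => ⟨ht, Set.mem_univ _⟩)
    (by ext; simp [hY, hΦ0, precompDual_apply])
  filter_upwards [hu] with t ht
  rw [ht]
  have h1 : LinearMap.range (Y t).toLinearMap ≤
      (LinearMap.range (B t₀).toLinearMap).map (Φ t).toLinearMap := by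
    rintro _ ⟨α, rfl⟩
    exact ⟨B t₀ (precompDual E (Φ t) α), ⟨_, rfl⟩, rfl⟩
  exact (Submodule.finrank_mono h1).trans (Submodule.finrank_map_le _ _)

/-! ## The Schouten bracket on a vector space -/

/-- The trivector `[π, σ]` at `z`, up to sign, for bivector fields on a vector space. -/
noncomputable def schoutenForm (π σ : E → (E →L[ℝ] ℝ) →L[ℝ] E) (z : E) (α β γ : E →L[ℝ] ℝ) : ℝ :=
  (β (fderiv ℝ π z (σ z γ) α) + β (fderiv ℝ σ z (π z γ) α)) +
  (γ (fderiv ℝ π z (σ z α) β) + γ (fderiv ℝ σ z (π z α) β)) +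
  (α (fderiv ℝ π z (σ z β) γ) + α (fderiv ℝ σ z (π z β) γ))

/-- The bracket of functions on a vector space. -/
noncomputable def vectorBracket (π : E → (E →L[ℝ] ℝ) →L[ℝ] E) (f g : E → ℝ) (z : E) : ℝ :=
  fderiv ℝ g z (π z (fderiv ℝ f z))

theorem fderiv_vectorBracket (π : E → (E →L[ℝ] ℝ) →L[ℝ] E) (f g : E → ℝ) (z : E)
    (hπ : DifferentiableAt ℝ π z) (hf : ContDiffAt ℝ 2 f z) (hg : ContDiffAt ℝ 2 g z)
    (hskew : ∀ α β : E →L[ℝ] ℝ, β (π z α) = - α (π z β)) (v : E) :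
    fderiv ℝ (vectorBracket π f g) z v =
      fderiv ℝ (fderiv ℝ g) z v (π z (fderiv ℝ f z)) + fderiv ℝ g z (fderiv ℝ π z v (fderiv ℝ f z))
        - fderiv ℝ (fderiv ℝ f) z v (π z (fderiv ℝ g z)) := by
  have hf' := ((hf.fderiv_right (m := 1) (by norm_num)).differentiableAt one_ne_zero).hasFDerivAt
  have hg' := ((hg.fderiv_right (m := 1) (by norm_num)).differentiableAt one_ne_zero).hasFDerivAt
  have h := hg'.clm_apply (hπ.hasFDerivAt.clm_apply hf')
  have h' : HasFDerivAt (vectorBracket π f g) _ z := h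
  rw [h'.fderiv]
  simp only [add_apply, ContinuousLinearMap.comp_apply,
    ContinuousLinearMap.flip_apply, map_add]
  rw [hskew (fderiv ℝ (fderiv ℝ f) z v)]
  ring

/-- The Hessian terms cancel in pairs by symmetry of second derivatives, so only first differentials
survive and the expression is a tensor. -/
theorem vectorBracket_cyclic_sum (π σ : E → (E →L[ℝ] ℝ) →L[ℝ] E) (f g h : E → ℝ) (z : E)
    (hπ : DifferentiableAt ℝ π z) (hσ : DifferentiableAt ℝ σ z)
    (hf : ContDiffAt ℝ 2 f z) (hg : ContDiffAt ℝ 2 g z) (hh : ContDiffAt ℝ 2 h z)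
    (hπs : ∀ α β : E →L[ℝ] ℝ, β (π z α) = - α (π z β))
    (hσs : ∀ α β : E →L[ℝ] ℝ, β (σ z α) = - α (σ z β)) :
    (vectorBracket σ (vectorBracket π f g) h z + vectorBracket π (vectorBracket σ f g) h z) +
    (vectorBracket σ (vectorBracket π g h) f z + vectorBracket π (vectorBracket σ g h) f z) +
    (vectorBracket σ (vectorBracket π h f) g z + vectorBracket π (vectorBracket σ h f) g z) =
      - schoutenForm π σ z (fderiv ℝ f z) (fderiv ℝ g z) (fderiv ℝ h z) := by
  have key : ∀ (ρ τ : E → (E →L[ℝ] ℝ) →L[ℝ] E) (a b c : E → ℝ),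
      (∀ α β : E →L[ℝ] ℝ, β (τ z α) = - α (τ z β)) →
      vectorBracket τ (vectorBracket ρ a b) c z =
        - fderiv ℝ (vectorBracket ρ a b) z (τ z (fderiv ℝ c z)) := fun ρ τ a b c hτ => by
    rw [vectorBracket, hτ]
  have sym : ∀ a : E → ℝ, ContDiffAt ℝ 2 a z → ∀ v w,
      fderiv ℝ (fderiv ℝ a) z v w = fderiv ℝ (fderiv ℝ a) z w v := fun a ha v w =>
    (ha.isSymmSndFDerivAt (by simp)).eq v w
  simp only [key _ _ _ _ _ hπs, key _ _ _ _ _ hσs]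
  rw [fderiv_vectorBracket π f g z hπ hf hg hπs, fderiv_vectorBracket π g h z hπ hg hh hπs,
    fderiv_vectorBracket π h f z hπ hh hf hπs, fderiv_vectorBracket σ f g z hσ hf hg hσs,
    fderiv_vectorBracket σ g h z hσ hg hh hσs, fderiv_vectorBracket σ h f z hσ hh hf hσs]
  rw [sym f hf (σ z (fderiv ℝ h z)), sym g hg (σ z (fderiv ℝ f z)), sym h hh (σ z (fderiv ℝ g z)),
    sym f hf (π z (fderiv ℝ h z)), sym g hg (π z (fderiv ℝ f z)), sym h hh (π z (fderiv ℝ g z))]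
  unfold schoutenForm
  ring

end Calculus

/-! ## The pointwise splitting of a skew map -/

section Pointwise

variable {T : Type*} [AddCommGroup T] [Module ℝ T] [TopologicalSpace T] [IsTopologicalAddGroup T]
  [ContinuousSMul ℝ T]

/-- `B` is the vertical part of `A`: it agrees with `A` on the covectors that `A` maps to `V`, and
vanishes on the annihilator of `V`. -/
structure IsVerticalPart (V : Submodule ℝ T) (A B : (T →L[ℝ] ℝ) →L[ℝ] T) : Prop where
  eq_of_mem : ∀ a, A a ∈ V → B a = A a
  eq_zero : ∀ b : T →L[ℝ] ℝ, (∀ v ∈ V, b v = 0) → B b = 0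

variable [T2Space T] [FiniteDimensional ℝ T]

theorem eq_zero_of_forall_clm_eq_zero (w : T) (h : ∀ ξ : T →L[ℝ] ℝ, ξ w = 0) : w = 0 :=
  (Module.forall_dual_apply_eq_zero_iff ℝ w).1 fun f => h (LinearMap.toContinuousLinearMap f)

theorem mem_of_forall_annihilator (V : Submodule ℝ T) (w : T)
    (h : ∀ ξ : T →L[ℝ] ℝ, (∀ v ∈ V, ξ v = 0) → ξ w = 0) : w ∈ V := by
  by_contra hw
  obtain ⟨f, hf, hV⟩ := V.exists_le_ker_of_notMem hw
  exact hf (h (LinearMap.toContinuousLinearMap f) fun v hv => hV hv)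

variable {V : Submodule ℝ T} {A B : (T →L[ℝ] ℝ) →L[ℝ] T}

/-- There is a projection `q` vanishing on `V` and restricting to the identity on `A V°`. -/
theorem exists_horizontal_projection
    (hdisj : ∀ b : T →L[ℝ] ℝ, (∀ v ∈ V, b v = 0) → A b ∈ V → A b = 0) :
    ∃ q : T →L[ℝ] T, (∀ v ∈ V, q v = 0) ∧
      ∀ b : T →L[ℝ] ℝ, (∀ v ∈ V, b v = 0) → q (A b) = A b := by
  let U : Submodule ℝ T :=
    { carrier := {w | ∃ b : T →L[ℝ] ℝ, (∀ v ∈ V, b v = 0) ∧ A b = w}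
      add_mem' := by
        rintro _ _ ⟨b, hb, rfl⟩ ⟨c, hc, rfl⟩
        exact ⟨b + c, fun v hv => by simp [hb v hv, hc v hv], by simp⟩
      zero_mem' := ⟨0, by simp, by simp⟩
      smul_mem' := by
        rintro r _ ⟨b, hb, rfl⟩
        exact ⟨r • b, fun v hv => by simp [hb v hv], by simp⟩ }
  have hUV : Disjoint U V := by
    rw [Submodule.disjoint_def]
    rintro _ ⟨b, hb, rfl⟩ hV
    exact hdisj b hb hV
  obtain ⟨C, hC, hUC⟩ := hUV.exists_isCompl
  refine ⟨LinearMap.toContinuousLinearMap (C.subtype ∘ₗ C.projectionOnto V hUC), ?_, ?_⟩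
  · intro v hv
    simpa using (Submodule.projectionOnto_apply_eq_zero_iff hUC).2 hv
  · intro b hb
    have := Submodule.projectionOnto_apply_left hUC (⟨A b, hC ⟨b, hb, rfl⟩⟩ : C)
    simpa using congrArg Subtype.val this

variable (hskew : ∀ α β : T →L[ℝ] ℝ, β (A α) = - α (A β))
  (hdisj : ∀ b : T →L[ℝ] ℝ, (∀ v ∈ V, b v = 0) → A b ∈ V → A b = 0)

include hskew hdisj

/-- This is the dual form of `A V° ∩ V = 0`. The part `η ∘ q` kills `V`, and `η - η ∘ q` kills `A
V°`, which by skewness means that `A` sends it into `V`. -/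
theorem exists_covector_splitting (η : T →L[ℝ] ℝ) :
    ∃ a b : T →L[ℝ] ℝ, η = a + b ∧ A a ∈ V ∧ ∀ v ∈ V, b v = 0 := by
  obtain ⟨q, hq0, hq⟩ := exists_horizontal_projection hdisj
  refine ⟨η - η.comp q, η.comp q, by simp, ?_, fun v hv => by simp [hq0 v hv]⟩
  refine mem_of_forall_annihilator V _ fun b hb => ?_
  rw [hskew]
  simp [hq b hb]

/-- The map `η ↦ A (η - η ∘ q)` works: if `A a` lies in `V`, then `A (a ∘ q)` lies in `V ∩ A V°` and
vanishes; if `b` kills `V`, then so does `A (b - b ∘ q)`. -/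
theorem exists_isVerticalPart : ∃ B, IsVerticalPart V A B := by
  obtain ⟨q, hq0, hq⟩ := exists_horizontal_projection hdisj
  have hK : ∀ η : T →L[ℝ] ℝ, A (η - η.comp q) ∈ V := fun η => by
    refine mem_of_forall_annihilator V _ fun b hb => ?_
    rw [hskew]
    simp [hq b hb]
  let L : (T →L[ℝ] ℝ) →L[ℝ] (T →L[ℝ] ℝ) := ContinuousLinearMap.precomp ℝ q
  refine ⟨A - A.comp L, ⟨fun a ha => ?_, fun b hb => ?_⟩⟩
  · have hb : ∀ v ∈ V, (a.comp q) v = 0 := fun v hv => by simp [hq0 v hv]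
    have h := hdisj _ hb (by
      have := V.sub_mem ha (hK a)
      simpa using this)
    change A a - A (a.comp q) = A a
    rw [h, sub_zero]
  · change A b - A (b.comp q) = 0
    rw [← map_sub]
    refine hdisj _ (fun v hv => ?_) (hK b)
    simp [hb v hv, hq0 v hv]

theorem IsVerticalPart.apply_mem (h : IsVerticalPart V A B) (η : T →L[ℝ] ℝ) : B η ∈ V := by
  obtain ⟨a, b, rfl, ha, hb⟩ := exists_covector_splitting hskew hdisj η
  rw [map_add, h.eq_zero b hb, h.eq_of_mem a ha, add_zero]
  exact ha

theorem IsVerticalPart.skew (h : IsVerticalPart V A B) (α β : T →L[ℝ] ℝ) :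
    β (B α) = - α (B β) := by
  obtain ⟨a, b, rfl, ha, hb⟩ := exists_covector_splitting hskew hdisj α
  obtain ⟨a', b', rfl, ha', hb'⟩ := exists_covector_splitting hskew hdisj β
  simp [h.eq_zero _ hb, h.eq_of_mem _ ha, h.eq_zero _ hb', h.eq_of_mem _ ha', hb _ ha', hb' _ ha,
    hskew a a']

theorem IsVerticalPart.range_sub (h : IsVerticalPart V A B) (w : T) :
    (∃ η, (A - B) η = w) ↔ ∃ b : T →L[ℝ] ℝ, (∀ v ∈ V, b v = 0) ∧ A b = w := by
  constructor
  · rintro ⟨η, rfl⟩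
    obtain ⟨a, b, rfl, ha, hb⟩ := exists_covector_splitting hskew hdisj η
    exact ⟨b, hb, by simp [h.eq_zero b hb, h.eq_of_mem a ha]⟩
  · rintro ⟨b, hb, rfl⟩
    exact ⟨b, by simp [h.eq_zero b hb]⟩

theorem IsVerticalPart.exists_sub_apply_eq (h : IsVerticalPart V A B) (η : T →L[ℝ] ℝ) :
    ∃ b : T →L[ℝ] ℝ, (∀ v ∈ V, b v = 0) ∧ (A - B) η = A b := by
  obtain ⟨b, hb, e⟩ := (h.range_sub hskew hdisj ((A - B) η)).1 ⟨η, rfl⟩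
  exact ⟨b, hb, e.symm⟩

theorem IsVerticalPart.sub_apply_eq_zero_of_mem (h : IsVerticalPart V A B) (η : T →L[ℝ] ℝ)
    (hη : (A - B) η ∈ V) : (A - B) η = 0 := by
  obtain ⟨b, hb, e⟩ := h.exists_sub_apply_eq hskew hdisj η
  rw [e] at hη ⊢
  exact hdisj b hb hη

omit hdisj

/-- The vertical part is determined by a decomposition into a vertical and a transverse part. -/
theorem IsVerticalPart.of_add {H : (T →L[ℝ] ℝ) →L[ℝ] T}
    (hB : ∀ α β : T →L[ℝ] ℝ, β (B α) = - α (B β)) (hadd : A = B + H) (hBV : ∀ η, B η ∈ V)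
    (hH : ∀ η, H η ∈ V → H η = 0) : IsVerticalPart V A B := by
  subst hadd
  refine ⟨fun a ha => ?_, fun b hb => ?_⟩
  · have h1 : H a ∈ V := by simpa using V.sub_mem ha (hBV a)
    simp [hH a h1]
  · refine eq_zero_of_forall_clm_eq_zero _ fun ξ => ?_
    rw [hB, hb _ (hBV ξ), neg_zero]

/-- A skew map with range `A V°` which induces there the same form as `A` is the horizontal part. -/
theorem IsVerticalPart.of_form {P : (T →L[ℝ] ℝ) →L[ℝ] T}
    (hP : ∀ α β : T →L[ℝ] ℝ, β (P α) = - α (P β))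
    (hr : ∀ w, (∃ η, P η = w) ↔ ∃ b : T →L[ℝ] ℝ, (∀ v ∈ V, b v = 0) ∧ A b = w)
    (hform : ∀ ζ η b b' : T →L[ℝ] ℝ, (∀ v ∈ V, b v = 0) → (∀ v ∈ V, b' v = 0) → P ζ = A b →
      P η = A b' → η (P ζ) = b' (A b)) : IsVerticalPart V A (A - P) := by
  refine ⟨fun a ha => ?_, fun b hb => ?_⟩
  · suffices P a = 0 by simp [this]
    -- With `P ξ = A b`, skewness of both maps gives `ξ (P a) = -a (A b) = b (A a)`, and `b`
    -- annihilates `V`.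
    refine eq_zero_of_forall_clm_eq_zero _ fun ξ => ?_
    obtain ⟨b, hb, e⟩ := (hr (P ξ)).1 ⟨ξ, rfl⟩
    rw [hP, ← e, hskew, hb _ ha, neg_zero, neg_zero]
  · suffices A b - P b = 0 by simpa using this
    refine eq_zero_of_forall_clm_eq_zero _ fun ξ => ?_
    obtain ⟨b', hb', e'⟩ := (hr (P ξ)).1 ⟨ξ, rfl⟩
    obtain ⟨ζ, e⟩ := (hr (A b)).2 ⟨b, hb, rfl⟩
    have h1 := hform ζ ξ b b' hb hb' e e'.symm
    have h2 : ξ (P b) = b' (A b) := by rw [hP, ← e', hskew]; simp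
    rw [map_sub, h2, ← e, h1, e, sub_self]

end Pointwise

/-! ## Tensor fields in charts -/

section Charts

open Bundle

variable {E : Type*} [NormedAddCommGroup E] [NormedSpace ℝ E]
  {M : Type*} [TopologicalSpace M] [ChartedSpace E M] [IsManifold 𝓘(ℝ, E) ∞ M]

/-- The derivative at `y` of the chart centred at `x₀`. -/
noncomputable def chartDeriv (E : Type*) [NormedAddCommGroup E] [NormedSpace ℝ E]
    {M : Type*} [TopologicalSpace M] [ChartedSpace E M] [IsManifold 𝓘(ℝ, E) ∞ M] (x₀ y : M) :
    TangentSpace 𝓘(ℝ, E) y →L[ℝ] E :=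
  (trivializationAt E (TangentSpace 𝓘(ℝ, E)) x₀).continuousLinearMapAt ℝ y

/-- The inverse of `chartDeriv`. -/
noncomputable def chartDerivSymm (E : Type*) [NormedAddCommGroup E] [NormedSpace ℝ E]
    {M : Type*} [TopologicalSpace M] [ChartedSpace E M] [IsManifold 𝓘(ℝ, E) ∞ M] (x₀ y : M) :
    E →L[ℝ] TangentSpace 𝓘(ℝ, E) y :=
  (trivializationAt E (TangentSpace 𝓘(ℝ, E)) x₀).symmL ℝ y

variable {x₀ y : M}

theorem chartDerivSymm_chartDeriv (hy : y ∈ (chartAt E x₀).source) (v : TangentSpace 𝓘(ℝ, E) y) :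
    chartDerivSymm E x₀ y (chartDeriv E x₀ y v) = v :=
  (trivializationAt E (TangentSpace 𝓘(ℝ, E)) x₀).symmL_continuousLinearMapAt (by simpa using hy) v

theorem chartDeriv_chartDerivSymm (hy : y ∈ (chartAt E x₀).source) (v : E) :
    chartDeriv E x₀ y (chartDerivSymm E x₀ y v) = v :=
  (trivializationAt E (TangentSpace 𝓘(ℝ, E)) x₀).continuousLinearMapAt_symmL (by simpa using hy) v

theorem chartDeriv_eq_mfderiv (hy : y ∈ (chartAt E x₀).source) :
    chartDeriv E x₀ y = mfderiv 𝓘(ℝ, E) 𝓘(ℝ, E) (extChartAt 𝓘(ℝ, E) x₀) y :=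
  TangentBundle.continuousLinearMapAt_trivializationAt hy

theorem comp_chartDeriv_comp_chartDerivSymm (hy : y ∈ (chartAt E x₀).source) (α : E →L[ℝ] ℝ) :
    (α.comp (chartDeriv E x₀ y)).comp (chartDerivSymm E x₀ y) = α := by
  ext v
  simp [chartDeriv_chartDerivSymm hy]

theorem comp_chartDerivSymm_comp_chartDeriv (hy : y ∈ (chartAt E x₀).source)
    (α : CotangentAt E y) :
    (α.comp (chartDerivSymm E x₀ y)).comp (chartDeriv E x₀ y) = α := by
  ext v
  simp [chartDerivSymm_chartDeriv hy]

theorem tangent_trivializationAt_snd (hy : y ∈ (chartAt E x₀).source)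
    (v : TangentSpace 𝓘(ℝ, E) y) :
    (trivializationAt E (TangentSpace 𝓘(ℝ, E)) x₀ ⟨y, v⟩).2 = chartDeriv E x₀ y v := by
  rw [chartDeriv, Trivialization.continuousLinearMapAt_apply,
    Trivialization.coe_linearMapAt_of_mem _ (by simpa using hy)]

theorem cotangent_trivializationAt_snd (α : CotangentAt E y) :
    (trivializationAt (E →L[ℝ] ℝ) (fun y : M => CotangentAt E y) x₀ ⟨y, α⟩).2 =
      α.comp (chartDerivSymm E x₀ y) := by
  rw [hom_trivializationAt_apply]
  simp [ContinuousLinearMap.inCoordinates, chartDerivSymm]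

theorem cotangent_symmL (hy : y ∈ (chartAt E x₀).source) (α : E →L[ℝ] ℝ) :
    (trivializationAt (E →L[ℝ] ℝ) (fun y : M => CotangentAt E y) x₀).symmL ℝ y α =
      α.comp (chartDeriv E x₀ y) := by
  have h := (trivializationAt (E →L[ℝ] ℝ) (fun y : M => CotangentAt E y)
    x₀).symmL_continuousLinearMapAt (R := ℝ) (b := y) (by simpa using hy)
    (α.comp (chartDeriv E x₀ y))
  rw [← h]
  congr 1
  rw [Trivialization.continuousLinearMapAt_apply,
    Trivialization.coe_linearMapAt_of_mem _ (by simpa using hy)]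
  change α = (trivializationAt (E →L[ℝ] ℝ) (fun y : M => CotangentAt E y) x₀ ⟨y, _⟩).2
  rw [cotangent_trivializationAt_snd, comp_chartDeriv_comp_chartDerivSymm hy]

/-- The expression of a family of maps `T*M → TM` in the chart centred at `x₀`. -/
noncomputable def chartRep (x₀ : M) (A : ∀ x : M, CotangentAt E x →L[ℝ] TangentSpace 𝓘(ℝ, E) x)
    (z : E) : (E →L[ℝ] ℝ) →L[ℝ] E :=
  (chartDeriv E x₀ ((extChartAt 𝓘(ℝ, E) x₀).symm z)).comp
    ((A ((extChartAt 𝓘(ℝ, E) x₀).symm z)).comp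
      (ContinuousLinearMap.precomp ℝ (chartDeriv E x₀ ((extChartAt 𝓘(ℝ, E) x₀).symm z))))

theorem chartRep_apply (x₀ : M) (A : ∀ x : M, CotangentAt E x →L[ℝ] TangentSpace 𝓘(ℝ, E) x)
    (z : E) (α : E →L[ℝ] ℝ) :
    chartRep x₀ A z α = chartDeriv E x₀ ((extChartAt 𝓘(ℝ, E) x₀).symm z)
      (A ((extChartAt 𝓘(ℝ, E) x₀).symm z)
        (α.comp (chartDeriv E x₀ ((extChartAt 𝓘(ℝ, E) x₀).symm z)))) := rfl

theorem chartRep_chart_apply (A : ∀ x : M, CotangentAt E x →L[ℝ] TangentSpace 𝓘(ℝ, E) x)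
    (hy : y ∈ (chartAt E x₀).source) (α : E →L[ℝ] ℝ) :
    chartRep x₀ A (extChartAt 𝓘(ℝ, E) x₀ y) α =
      chartDeriv E x₀ y (A y (α.comp (chartDeriv E x₀ y))) := by
  rw [chartRep_apply, (extChartAt 𝓘(ℝ, E) x₀).left_inv (by simpa using hy)]

omit [IsManifold 𝓘(ℝ, E) ∞ M] in
theorem chart_symm_mem_source {z : E} (hz : z ∈ (extChartAt 𝓘(ℝ, E) x₀).target) :
    (extChartAt 𝓘(ℝ, E) x₀).symm z ∈ (chartAt E x₀).source := by
  simpa using (extChartAt 𝓘(ℝ, E) x₀).map_target hz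

omit [IsManifold 𝓘(ℝ, E) ∞ M] in
theorem extChartAt_target_mem_nhds_image (hy : y ∈ (chartAt E x₀).source) :
    (extChartAt 𝓘(ℝ, E) x₀).target ∈ nhds (extChartAt 𝓘(ℝ, E) x₀ y) :=
  (isOpen_extChartAt_target x₀).mem_nhds
    ((extChartAt 𝓘(ℝ, E) x₀).map_source (by simpa using hy))

omit [IsManifold 𝓘(ℝ, E) ∞ M] in
theorem contDiffAt_congr_iff {G : Type*} [NormedAddCommGroup G] [NormedSpace ℝ G] {f g : E → G}
    {z : E} (h : f =ᶠ[nhds z] g) : ContDiffAt ℝ ∞ f z ↔ ContDiffAt ℝ ∞ g z :=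
  ⟨fun hf => hf.congr_of_eventuallyEq h.symm, fun hg => hg.congr_of_eventuallyEq h⟩

theorem contMDiffAt_iff_chart {G : Type*} [NormedAddCommGroup G] [NormedSpace ℝ G]
    (hy : y ∈ (chartAt E x₀).source) (f : M → G) :
    ContMDiffAt 𝓘(ℝ, E) 𝓘(ℝ, G) ∞ f y ↔
      ContDiffAt ℝ ∞ (f ∘ (extChartAt 𝓘(ℝ, E) x₀).symm) (extChartAt 𝓘(ℝ, E) x₀ y) := by
  rw [contMDiffAt_iff_source_of_mem_source hy, contMDiffWithinAt_iff_contDiffWithinAt]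
  rw [ModelWithCorners.range_eq_univ, contDiffWithinAt_univ]

set_option synthInstance.maxHeartbeats 400000 in
set_option maxHeartbeats 1000000 in
-- This moves smoothness of sections of the Hom bundle to maps between fixed vector spaces, where
-- all differentiation below takes place.
theorem contMDiffAt_bivector_iff (hy : y ∈ (chartAt E x₀).source)
    (A : ∀ x : M, CotangentAt E x →L[ℝ] TangentSpace 𝓘(ℝ, E) x) :
    ContMDiffAt 𝓘(ℝ, E) (𝓘(ℝ, E).prod 𝓘(ℝ, (E →L[ℝ] ℝ) →L[ℝ] E)) ∞
      (fun x => TotalSpace.mk' ((E →L[ℝ] ℝ) →L[ℝ] E)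
        (E := fun y : M => CotangentAt E y →L[ℝ] TangentSpace 𝓘(ℝ, E) y) x (A x)) y ↔
      ContDiffAt ℝ ∞ (chartRep x₀ A) (extChartAt 𝓘(ℝ, E) x₀ y) := by
  rw [(trivializationAt ((E →L[ℝ] ℝ) →L[ℝ] E)
    (fun y : M => CotangentAt E y →L[ℝ] TangentSpace 𝓘(ℝ, E) y) x₀).contMDiffAt_section_iff
    (by simpa using hy), contMDiffAt_iff_chart hy]
  refine contDiffAt_congr_iff ?_
  filter_upwards [extChartAt_target_mem_nhds_image hy] with z hz
  refine ContinuousLinearMap.ext fun α => ?_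
  rw [chartRep_apply, ← cotangent_symmL (chart_symm_mem_source hz)]
  rfl

theorem contMDiffAt_prod_section_iff (hy : y ∈ (chartAt E x₀).source)
    (s : ∀ x : M, TangentSpace 𝓘(ℝ, E) x × CotangentAt E x) :
    ContMDiffAt 𝓘(ℝ, E) (𝓘(ℝ, E).prod 𝓘(ℝ, E × (E →L[ℝ] ℝ))) ∞
      (fun x => TotalSpace.mk' (E × (E →L[ℝ] ℝ))
        (E := fun x : M => TangentSpace 𝓘(ℝ, E) x × CotangentAt E x) x (s x)) y ↔
      ContDiffAt ℝ ∞ (fun z => (chartDeriv E x₀ ((extChartAt 𝓘(ℝ, E) x₀).symm z)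
          (s ((extChartAt 𝓘(ℝ, E) x₀).symm z)).1,
        (s ((extChartAt 𝓘(ℝ, E) x₀).symm z)).2.comp
          (chartDerivSymm E x₀ ((extChartAt 𝓘(ℝ, E) x₀).symm z))))
        (extChartAt 𝓘(ℝ, E) x₀ y) := by
  rw [(trivializationAt (E × (E →L[ℝ] ℝ))
    (fun x : M => TangentSpace 𝓘(ℝ, E) x × CotangentAt E x) x₀).contMDiffAt_section_iff
    (by
      change y ∈ (trivializationAt E (TangentSpace 𝓘(ℝ, E)) x₀).baseSet ∩
        (trivializationAt (E →L[ℝ] ℝ) (fun y : M => CotangentAt E y) x₀).baseSet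
      simpa using hy), contMDiffAt_iff_chart hy]
  refine contDiffAt_congr_iff ?_
  filter_upwards [extChartAt_target_mem_nhds_image hy] with z hz
  rw [← tangent_trivializationAt_snd (chart_symm_mem_source hz), ← cotangent_trivializationAt_snd]
  rfl

theorem mvfderiv_eq_fderiv_comp_chartDeriv {G : Type*} [NormedAddCommGroup G] [NormedSpace ℝ G]
    (hy : y ∈ (chartAt E x₀).source) (f : M → G)
    (hf : ContMDiffAt 𝓘(ℝ, E) 𝓘(ℝ, G) ∞ f y) :
    mvfderiv 𝓘(ℝ, E) f y = (fderiv ℝ (f ∘ (extChartAt 𝓘(ℝ, E) x₀).symm)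
      (extChartAt 𝓘(ℝ, E) x₀ y)).comp (chartDeriv E x₀ y) := by
  have h1 : MDifferentiableAt 𝓘(ℝ, E) 𝓘(ℝ, G) (f ∘ (extChartAt 𝓘(ℝ, E) x₀).symm)
      (extChartAt 𝓘(ℝ, E) x₀ y) := by
    apply DifferentiableAt.mdifferentiableAt
    exact ((contMDiffAt_iff_chart hy f).1 hf).differentiableAt (by simp)
  have h2 := (mdifferentiableAt_extChartAt (I := 𝓘(ℝ, E)) hy)
  have h3 : f =ᶠ[nhds y] (f ∘ (extChartAt 𝓘(ℝ, E) x₀).symm) ∘ extChartAt 𝓘(ℝ, E) x₀ := by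
    filter_upwards [extChartAt_source_mem_nhds' (I := 𝓘(ℝ, E)) (x := x₀)
      (x' := y) (by simpa using hy)] with w hw
    rw [Function.comp_apply, Function.comp_apply, (extChartAt 𝓘(ℝ, E) x₀).left_inv hw]
  have h4 : mfderiv 𝓘(ℝ, E) 𝓘(ℝ, G) f y = (fderiv ℝ (f ∘ (extChartAt 𝓘(ℝ, E) x₀).symm)
      (extChartAt 𝓘(ℝ, E) x₀ y)).comp (chartDeriv E x₀ y) := by
    rw [h3.mfderiv_eq, mfderiv_comp y h1 h2, chartDeriv_eq_mfderiv hy, mfderiv_eq_fderiv]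
    rfl
  ext v
  exact congrArg (fun L => L v) h4

end Charts

/-! ### Brackets and the Schouten trivector in charts -/

namespace BivectorField

variable {E : Type*} [NormedAddCommGroup E] [NormedSpace ℝ E]
  {M : Type*} [TopologicalSpace M] [ChartedSpace E M] [IsManifold 𝓘(ℝ, E) ∞ M]
  {x₀ y : M} (π σ : BivectorField E M)

theorem contDiffAt_chartRep (hy : y ∈ (chartAt E x₀).source) :
    ContDiffAt ℝ ∞ (chartRep x₀ π.sharp) (extChartAt 𝓘(ℝ, E) x₀ y) :=
  (contMDiffAt_bivector_iff hy π.sharp).1 (π.smooth y)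

theorem contDiffAt_chartRep_of_mem_target {z : E} (hz : z ∈ (extChartAt 𝓘(ℝ, E) x₀).target) :
    ContDiffAt ℝ ∞ (chartRep x₀ π.sharp) z := by
  have := π.contDiffAt_chartRep (chart_symm_mem_source hz)
  rwa [(extChartAt 𝓘(ℝ, E) x₀).right_inv hz] at this

theorem chartRep_skew (z : E) (α β : E →L[ℝ] ℝ) :
    β (chartRep x₀ π.sharp z α) = - α (chartRep x₀ π.sharp z β) := by
  rw [chartRep_apply, chartRep_apply]
  exact π.skew _ (α.comp (chartDeriv E x₀ _)) (β.comp (chartDeriv E x₀ _))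

theorem bracket_eq_vectorBracket (hy : y ∈ (chartAt E x₀).source) {f g : M → ℝ}
    (hf : ContMDiff 𝓘(ℝ, E) 𝓘(ℝ, ℝ) ∞ f) (hg : ContMDiff 𝓘(ℝ, E) 𝓘(ℝ, ℝ) ∞ g) :
    π.bracket f g y = vectorBracket (chartRep x₀ π.sharp) (f ∘ (extChartAt 𝓘(ℝ, E) x₀).symm)
      (g ∘ (extChartAt 𝓘(ℝ, E) x₀).symm) (extChartAt 𝓘(ℝ, E) x₀ y) := by
  rw [bracket, hamiltonian, vectorBracket, chartRep_chart_apply _ hy,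
    mvfderiv_eq_fderiv_comp_chartDeriv hy f (hf y), mvfderiv_eq_fderiv_comp_chartDeriv hy g (hg y)]
  rfl

theorem bracket_comp_chart_eventuallyEq (hy : y ∈ (chartAt E x₀).source) {f g : M → ℝ}
    (hf : ContMDiff 𝓘(ℝ, E) 𝓘(ℝ, ℝ) ∞ f) (hg : ContMDiff 𝓘(ℝ, E) 𝓘(ℝ, ℝ) ∞ g) :
    π.bracket f g ∘ (extChartAt 𝓘(ℝ, E) x₀).symm =ᶠ[nhds (extChartAt 𝓘(ℝ, E) x₀ y)]
      vectorBracket (chartRep x₀ π.sharp) (f ∘ (extChartAt 𝓘(ℝ, E) x₀).symm)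
        (g ∘ (extChartAt 𝓘(ℝ, E) x₀).symm) := by
  filter_upwards [extChartAt_target_mem_nhds_image hy] with z hz
  rw [Function.comp_apply, π.bracket_eq_vectorBracket (chart_symm_mem_source hz) hf hg,
    (extChartAt 𝓘(ℝ, E) x₀).right_inv hz]

theorem contMDiff_bracket {f g : M → ℝ}
    (hf : ContMDiff 𝓘(ℝ, E) 𝓘(ℝ, ℝ) ∞ f) (hg : ContMDiff 𝓘(ℝ, E) 𝓘(ℝ, ℝ) ∞ g) :
    ContMDiff 𝓘(ℝ, E) 𝓘(ℝ, ℝ) ∞ (π.bracket f g) := by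
  intro y
  have hy := mem_chart_source E y
  rw [contMDiffAt_iff_chart hy, contDiffAt_congr_iff (π.bracket_comp_chart_eventuallyEq hy hf hg)]
  have hf' := ((contMDiffAt_iff_chart hy f).1 (hf y)).fderiv_right (m := ∞) (by simp)
  have hg' := ((contMDiffAt_iff_chart hy g).1 (hg y)).fderiv_right (m := ∞) (by simp)
  exact hg'.clm_apply ((π.contDiffAt_chartRep hy).clm_apply hf')

/-- The right side depends on the functions only through their differentials at `y`, so they may be
exchanged for convenient ones with the same differentials. -/
theorem schouten_eq_neg_schoutenForm (hy : y ∈ (chartAt E x₀).source) {f g h : M → ℝ}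
    (hf : ContMDiff 𝓘(ℝ, E) 𝓘(ℝ, ℝ) ∞ f) (hg : ContMDiff 𝓘(ℝ, E) 𝓘(ℝ, ℝ) ∞ g)
    (hh : ContMDiff 𝓘(ℝ, E) 𝓘(ℝ, ℝ) ∞ h) :
    schouten π σ f g h y = - schoutenForm (chartRep x₀ π.sharp) (chartRep x₀ σ.sharp)
      (extChartAt 𝓘(ℝ, E) x₀ y)
      (fderiv ℝ (f ∘ (extChartAt 𝓘(ℝ, E) x₀).symm) (extChartAt 𝓘(ℝ, E) x₀ y))
      (fderiv ℝ (g ∘ (extChartAt 𝓘(ℝ, E) x₀).symm) (extChartAt 𝓘(ℝ, E) x₀ y))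
      (fderiv ℝ (h ∘ (extChartAt 𝓘(ℝ, E) x₀).symm) (extChartAt 𝓘(ℝ, E) x₀ y)) := by
  have key : ∀ (ρ τ : BivectorField E M) (a b c : M → ℝ), ContMDiff 𝓘(ℝ, E) 𝓘(ℝ, ℝ) ∞ a →
      ContMDiff 𝓘(ℝ, E) 𝓘(ℝ, ℝ) ∞ b → ContMDiff 𝓘(ℝ, E) 𝓘(ℝ, ℝ) ∞ c →
      τ.bracket (ρ.bracket a b) c y = vectorBracket (chartRep x₀ τ.sharp)
        (vectorBracket (chartRep x₀ ρ.sharp) (a ∘ (extChartAt 𝓘(ℝ, E) x₀).symm)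
          (b ∘ (extChartAt 𝓘(ℝ, E) x₀).symm)) (c ∘ (extChartAt 𝓘(ℝ, E) x₀).symm)
        (extChartAt 𝓘(ℝ, E) x₀ y) := by
    intro ρ τ a b c ha hb hc
    rw [τ.bracket_eq_vectorBracket hy (ρ.contMDiff_bracket ha hb) hc, vectorBracket, vectorBracket,
      (ρ.bracket_comp_chart_eventuallyEq hy ha hb).fderiv_eq]
  have hd : ∀ a : M → ℝ, ContMDiff 𝓘(ℝ, E) 𝓘(ℝ, ℝ) ∞ a →
      ContDiffAt ℝ 2 (a ∘ (extChartAt 𝓘(ℝ, E) x₀).symm) (extChartAt 𝓘(ℝ, E) x₀ y) := fun a ha =>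
    ((contMDiffAt_iff_chart hy a).1 (ha y)).of_le ENat.LEInfty.out
  rw [schouten, key π σ f g h hf hg hh, key σ π f g h hf hg hh, key π σ g h f hg hh hf,
    key σ π g h f hg hh hf, key π σ h f g hh hf hg, key σ π h f g hh hf hg]
  exact vectorBracket_cyclic_sum _ _ _ _ _ _
    ((π.contDiffAt_chartRep hy).differentiableAt (by simp))
    ((σ.contDiffAt_chartRep hy).differentiableAt (by simp)) (hd f hf) (hd g hg) (hd h hh)
    (π.chartRep_skew _) (σ.chartRep_skew _)

/-- Lets a vanishing statement pass from a dense set of points to all points. -/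
theorem continuous_schouten {f g h : M → ℝ}
    (hf : ContMDiff 𝓘(ℝ, E) 𝓘(ℝ, ℝ) ∞ f) (hg : ContMDiff 𝓘(ℝ, E) 𝓘(ℝ, ℝ) ∞ g)
    (hh : ContMDiff 𝓘(ℝ, E) 𝓘(ℝ, ℝ) ∞ h) : Continuous (schouten π σ f g h) := by
  have key : ∀ (ρ τ : BivectorField E M) (a b c : M → ℝ), ContMDiff 𝓘(ℝ, E) 𝓘(ℝ, ℝ) ∞ a →
      ContMDiff 𝓘(ℝ, E) 𝓘(ℝ, ℝ) ∞ b → ContMDiff 𝓘(ℝ, E) 𝓘(ℝ, ℝ) ∞ c →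
      Continuous (τ.bracket (ρ.bracket a b) c) := fun ρ τ a b c ha hb hc =>
    (τ.contMDiff_bracket (ρ.contMDiff_bracket ha hb) hc).continuous
  unfold schouten
  exact (((key _ _ _ _ _ hf hg hh).add (key _ _ _ _ _ hf hg hh)).add
    ((key _ _ _ _ _ hg hh hf).add (key _ _ _ _ _ hg hh hf))).add
    ((key _ _ _ _ _ hh hf hg).add (key _ _ _ _ _ hh hf hg))

end BivectorField

/-! ### Global functions with prescribed differentials -/

section Functions

variable {E : Type*} [NormedAddCommGroup E] [NormedSpace ℝ E] [FiniteDimensional ℝ E]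
  {M : Type*} [TopologicalSpace M] [T2Space M] [ChartedSpace E M] [IsManifold 𝓘(ℝ, E) ∞ M]

/-- A compactly supported extension of a chart. -/
theorem exists_compactlySupported_chart (E : Type*) [NormedAddCommGroup E] [NormedSpace ℝ E]
    [FiniteDimensional ℝ E] {M : Type*} [TopologicalSpace M] [T2Space M] [ChartedSpace E M]
    [IsManifold 𝓘(ℝ, E) ∞ M] (m : M) :
    ∃ ψ : M → E, ContMDiff 𝓘(ℝ, E) 𝓘(ℝ, E) ∞ ψ ∧ HasCompactSupport ψ ∧
      ψ =ᶠ[nhds m] extChartAt 𝓘(ℝ, E) m := by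
  obtain ⟨f⟩ : Nonempty (SmoothBumpFunction 𝓘(ℝ, E) m) := inferInstance
  refine ⟨fun x => f x • extChartAt 𝓘(ℝ, E) m x,
    f.contMDiff_smul (contMDiffOn_extChartAt), f.hasCompactSupport.smul_right, ?_⟩
  filter_upwards [f.eventuallyEq_one] with x hx
  simp [hx]

omit [T2Space M] [FiniteDimensional ℝ E] in
theorem mvfderiv_comp_chart {ψ : M → E} {m : M}
    (hψ : ψ =ᶠ[nhds m] extChartAt 𝓘(ℝ, E) m) : mvfderiv 𝓘(ℝ, E) ψ m = chartDeriv E m m := by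
  rw [chartDeriv_eq_mfderiv (mem_chart_source E m), ← hψ.mfderiv_eq]
  rfl

/-- Every covector is the differential of a global function. -/
theorem exists_contMDiff_mvfderiv_eq (m : M) (α : CotangentAt E m) :
    ∃ f : M → ℝ, ContMDiff 𝓘(ℝ, E) 𝓘(ℝ, ℝ) ∞ f ∧ mvfderiv 𝓘(ℝ, E) f m = α := by
  obtain ⟨ψ, hψ, -, hψm⟩ := exists_compactlySupported_chart E m
  set a : E →L[ℝ] ℝ := α.comp (chartDerivSymm E m m) with ha
  have hsm : ContMDiff 𝓘(ℝ, E) 𝓘(ℝ, ℝ) ∞ fun x => a (ψ x) := a.contMDiff.comp hψ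
  refine ⟨fun x => a (ψ x), hsm, ?_⟩
  have hm := mem_chart_source E m
  rw [mvfderiv_eq_fderiv_comp_chartDeriv hm _ (hsm m)]
  have h1 : (fun x => a (ψ x)) ∘ (extChartAt 𝓘(ℝ, E) m).symm =ᶠ[nhds (extChartAt 𝓘(ℝ, E) m m)] a := by
    have hc : Filter.Tendsto (extChartAt 𝓘(ℝ, E) m).symm (nhds (extChartAt 𝓘(ℝ, E) m m))
        (nhds m) := by
      have := (continuousAt_extChartAt_symm (I := 𝓘(ℝ, E)) m).tendsto
      rwa [extChartAt_to_inv] at this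
    filter_upwards [hc hψm, extChartAt_target_mem_nhds_image hm] with z hz hz'
    have hz2 : ψ ((extChartAt 𝓘(ℝ, E) m).symm z) =
      extChartAt 𝓘(ℝ, E) m ((extChartAt 𝓘(ℝ, E) m).symm z) := hz
    rw [Function.comp_apply, hz2, (extChartAt 𝓘(ℝ, E) m).right_inv hz']
  rw [h1.fderiv_eq, ContinuousLinearMap.fderiv, ha, comp_chartDerivSymm_comp_chartDeriv hm]

end Functions

namespace BivectorField

variable {E : Type*} [NormedAddCommGroup E] [NormedSpace ℝ E] [FiniteDimensional ℝ E]
  {M : Type*} [TopologicalSpace M] [T2Space M] [ChartedSpace E M] [IsManifold 𝓘(ℝ, E) ∞ M]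
  {x₀ y : M} {π σ : BivectorField E M}

theorem Commute.schoutenForm_eq_zero (hc : π.Commute σ) (hy : y ∈ (chartAt E x₀).source)
    (α β γ : E →L[ℝ] ℝ) :
    schoutenForm (chartRep x₀ π.sharp) (chartRep x₀ σ.sharp) (extChartAt 𝓘(ℝ, E) x₀ y) α β γ = 0 := by
  have key : ∀ α : E →L[ℝ] ℝ, ∃ f : M → ℝ, ContMDiff 𝓘(ℝ, E) 𝓘(ℝ, ℝ) ∞ f ∧
      fderiv ℝ (f ∘ (extChartAt 𝓘(ℝ, E) x₀).symm) (extChartAt 𝓘(ℝ, E) x₀ y) = α := by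
    intro α
    obtain ⟨f, hf, hfy⟩ := exists_contMDiff_mvfderiv_eq y (α.comp (chartDeriv E x₀ y))
    refine ⟨f, hf, ?_⟩
    rw [mvfderiv_eq_fderiv_comp_chartDeriv hy f (hf y)] at hfy
    rw [← comp_chartDeriv_comp_chartDerivSymm hy (fderiv ℝ _ _), hfy,
      comp_chartDeriv_comp_chartDerivSymm hy]
  obtain ⟨f, hf, rfl⟩ := key α
  obtain ⟨g, hg, rfl⟩ := key β
  obtain ⟨h, hh, rfl⟩ := key γ
  have := hc f g h hf hg hh y
  rwa [schouten_eq_neg_schoutenForm π σ hy hf hg hh, neg_eq_zero] at this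

end BivectorField

/-! ## The Schouten brackets of the vertical and horizontal parts -/

/-- On each nonempty open set a bounded integer function attains its maximum, and a maximum point is
locally maximal. Applied to the rank of `πH`. -/
theorem dense_setOf_eventually_le {X : Type*} [TopologicalSpace X] (r : X → ℕ) (N : ℕ)
    (hr : ∀ x, r x ≤ N) : Dense {x | ∀ᶠ y in nhds x, r y ≤ r x} := by
  rw [dense_iff_inter_open]
  intro U hU hne
  obtain ⟨_, ⟨x, hx, rfl⟩, hmax⟩ := Set.Finite.exists_maximal (s := r '' U)
    ((Set.finite_Iic N).subset (by rintro _ ⟨x, -, rfl⟩; exact hr x)) (hne.image r)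
  refine ⟨x, hx, ?_⟩
  filter_upwards [hU.mem_nhds hx] with y hy
  rcases le_total (r y) (r x) with h | h
  · exact h
  · exact hmax ⟨y, hy, rfl⟩ h

/-- A cyclic trilinear function which vanishes on triples of elements of `K ∪ W` vanishes, if `K` and
`W` generate. -/
theorem cyclic_trilinear_eq_zero {X : Type*} [AddCommGroup X] (T : X → X → X → ℝ)
    (hadd : ∀ a a' b c, T (a + a') b c = T a b c + T a' b c) (hcyc : ∀ a b c, T a b c = T b c a)
    (K W : X → Prop) (hdec : ∀ x, ∃ a b, x = a + b ∧ K a ∧ W b)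
    (hK : ∀ a b c, K a → K b → K c → T a b c = 0)
    (hKW : ∀ a b c, K a → K b → W c → T a b c = 0)
    (hW : ∀ a b c, W a → W b → T a b c = 0) (a b c : X) : T a b c = 0 := by
  have hadd2 : ∀ a b b' c, T a (b + b') c = T a b c + T a b' c := fun a b b' c => by
    rw [hcyc, hadd, ← hcyc a, ← hcyc a]
  have hadd3 : ∀ a b c c', T a b (c + c') = T a b c + T a b c' := fun a b c c' => by
    rw [← hcyc, hadd, hcyc c, hcyc c']
  obtain ⟨a, a', rfl, ha, ha'⟩ := hdec a
  obtain ⟨b, b', rfl, hb, hb'⟩ := hdec b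
  obtain ⟨c, c', rfl, hc, hc'⟩ := hdec c
  simp only [hadd, hadd2, hadd3]
  have e1 : T a b' c = 0 := by rw [← hcyc]; exact hKW _ _ _ hc ha hb'
  have e2 : T a b' c' = 0 := by rw [hcyc]; exact hW _ _ _ hb' hc'
  have e3 : T a' b c = 0 := by rw [hcyc]; exact hKW _ _ _ hb hc ha'
  have e4 : T a' b c' = 0 := by rw [← hcyc]; exact hW _ _ _ hc' ha'
  rw [hK _ _ _ ha hb hc, hKW _ _ _ ha hb hc', e1, e2, e3, e4, hW _ _ _ ha' hb', hW _ _ _ ha' hb']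
  simp

section SchoutenForm

variable {E : Type*} [NormedAddCommGroup E] [NormedSpace ℝ E]
  (π σ : E → (E →L[ℝ] ℝ) →L[ℝ] E) (z : E)

theorem schoutenForm_cyclic (α β γ : E →L[ℝ] ℝ) :
    schoutenForm π σ z α β γ = schoutenForm π σ z β γ α := by
  unfold schoutenForm
  ring

theorem schoutenForm_add_left (α α' β γ : E →L[ℝ] ℝ) :
    schoutenForm π σ z (α + α') β γ = schoutenForm π σ z α β γ + schoutenForm π σ z α' β γ := by
  simp only [schoutenForm, map_add, add_apply]
  ring

/-- Polarization: with Jacobi for the sum, two of the three trivectors determine the remaining one.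
-/
theorem schoutenForm_add_self {ρ : E → (E →L[ℝ] ℝ) →L[ℝ] E} (hρ : ρ =ᶠ[nhds z] π + σ)
    (hπ : DifferentiableAt ℝ π z) (hσ : DifferentiableAt ℝ σ z) (α β γ : E →L[ℝ] ℝ) :
    schoutenForm ρ ρ z α β γ = schoutenForm π π z α β γ + 2 * schoutenForm π σ z α β γ +
      schoutenForm σ σ z α β γ := by
  have hd : fderiv ℝ (π + σ) z = fderiv ℝ π z + fderiv ℝ σ z :=
    fderiv_add (𝕜 := ℝ) (E := E) (F := (E →L[ℝ] ℝ) →L[ℝ] E) hπ hσ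
  simp only [schoutenForm, hρ.eq_of_nhds, hρ.fderiv_eq, hd, map_add, add_apply,
    Pi.add_apply]
  ring

end SchoutenForm

/-! ### Vertical and horizontal parts of the Poisson structure upstairs -/

section Splitting

variable {E : Type*} [NormedAddCommGroup E] [NormedSpace ℝ E] [FiniteDimensional ℝ E]
  {S : Type*} [TopologicalSpace S] [T2Space S] [ChartedSpace E S] [IsManifold 𝓘(ℝ, E) ∞ S]
  {F : Type*} [NormedAddCommGroup F] [NormedSpace ℝ F] [FiniteDimensional ℝ F]
  {M : Type*} [TopologicalSpace M] [T2Space M] [ChartedSpace F M] [IsManifold 𝓘(ℝ, F) ∞ M]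

instance tangentSpace_t2Space (x : S) : T2Space (TangentSpace 𝓘(ℝ, E) x) :=
  inferInstanceAs (T2Space E)

instance tangentSpace_finiteDimensional (x : S) : FiniteDimensional ℝ (TangentSpace 𝓘(ℝ, E) x) :=
  inferInstanceAs (FiniteDimensional ℝ E)

/-- The difference of two bivector fields. -/
noncomputable def BivectorField.sub (π σ : BivectorField E S) : BivectorField E S where
  sharp x := π.sharp x - σ.sharp x
  skew x α β := by
    simp only [sub_apply, map_sub, π.skew x α β, σ.skew x α β]
    ring
  smooth := by
    intro x
    have hx := mem_chart_source E x
    rw [contMDiffAt_bivector_iff hx]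
    refine ((π.contDiffAt_chartRep hx).sub (σ.contDiffAt_chartRep hx)).congr_of_eventuallyEq ?_
    refine Filter.Eventually.of_forall fun z => ContinuousLinearMap.ext fun α => ?_
    exact map_sub (chartDeriv E x _) _ _

omit [FiniteDimensional ℝ E] [T2Space S] in
theorem BivectorField.sub_sharp_apply (π σ : BivectorField E S) (x : S) (α : CotangentAt E x) :
    (π.sub σ).sharp x α = π.sharp x α - σ.sharp x α := rfl

/-- `πV` is fibrewise the vertical part of `πS`. -/
def IsVerticalPartField (F : Type*) [NormedAddCommGroup F] [NormedSpace ℝ F]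
    {M : Type*} [TopologicalSpace M] [ChartedSpace F M]
    (πS : BivectorField E S) (p : S → M) (πV : BivectorField E S) : Prop :=
  ∀ x, IsVerticalPart (verticalSpace E F p x) (πS.sharp x) (πV.sharp x)

variable {πS : BivectorField E S} {πM : BivectorField F M} {p : S → M}

omit [FiniteDimensional ℝ E] [FiniteDimensional ℝ F] [T2Space S] [T2Space M]
  [IsManifold 𝓘(ℝ, F) ∞ M] in
theorem HasCoregularFibres.apply_eq_zero (hcor : HasCoregularFibres F πS p) (x : S)
    (b : CotangentAt E x) (hb : ∀ v ∈ verticalSpace E F p x, b v = 0)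
    (hv : πS.sharp x b ∈ verticalSpace E F p x) : πS.sharp x b = 0 := by
  have h : πS.sharp x b ∈ horizontalSpace F πS p x ⊓ verticalSpace E F p x := ⟨⟨b, hb, rfl⟩, hv⟩
  rwa [(hcor (p x)).2 x rfl, Submodule.mem_bot] at h

omit [FiniteDimensional ℝ E] [FiniteDimensional ℝ F] [T2Space S] [T2Space M] in
theorem mvfderiv_comp_submersion {πS : BivectorField E S} {πM : BivectorField F M}
    (hp : IsPoissonSubmersion πS πM p)
    {G : Type*} [NormedAddCommGroup G] [NormedSpace ℝ G] {f : M → G}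
    (hf : ContMDiff 𝓘(ℝ, F) 𝓘(ℝ, G) ∞ f) (x : S) :
    mvfderiv 𝓘(ℝ, E) (f ∘ p) x =
      (mvfderiv 𝓘(ℝ, F) f (p x)).comp (mfderiv 𝓘(ℝ, E) 𝓘(ℝ, F) p x) := by
  have h := mfderiv_comp x ((hf (p x)).mdifferentiableAt (by simp))
    ((hp.smooth x).mdifferentiableAt (by simp))
  ext v
  exact congrArg (fun L => L v) h

omit [FiniteDimensional ℝ E] [FiniteDimensional ℝ F] [T2Space S] [T2Space M] in
theorem mvfderiv_comp_submersion_apply_vertical {πS : BivectorField E S} {πM : BivectorField F M}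
    (hp : IsPoissonSubmersion πS πM p) {f : M → ℝ}
    (hf : ContMDiff 𝓘(ℝ, F) 𝓘(ℝ, ℝ) ∞ f) (x : S) (v : TangentSpace 𝓘(ℝ, E) x)
    (hv : v ∈ verticalSpace E F p x) : mvfderiv 𝓘(ℝ, E) (f ∘ p) x v = 0 := by
  have hv' : mfderiv 𝓘(ℝ, E) 𝓘(ℝ, F) p x v = 0 := hv
  rw [mvfderiv_comp_submersion hp hf]
  simp [hv']

omit [FiniteDimensional ℝ E] [T2Space S] [T2Space M] in
/-- Covectors annihilating the fibres are pulled back. -/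
theorem exists_pullback_eq (hp : IsPoissonSubmersion πS πM p) (x : S) (b : CotangentAt E x)
    (hb : ∀ v ∈ verticalSpace E F p x, b v = 0) :
    ∃ c : CotangentAt F (p x), b = c.comp (mfderiv 𝓘(ℝ, E) 𝓘(ℝ, F) p x) := by
  set d := mfderiv 𝓘(ℝ, E) 𝓘(ℝ, F) p x with hd
  obtain ⟨s, hs⟩ := d.toLinearMap.exists_rightInverse_of_surjective
    (LinearMap.range_eq_top.2 (hp.submersion x))
  refine ⟨LinearMap.toContinuousLinearMap (b.toLinearMap ∘ₗ s), ?_⟩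
  ext v
  have h1 : d (s (d v)) = d v := LinearMap.congr_fun hs (d v)
  have h2 : v - s (d v) ∈ verticalSpace E F p x := by
    change d (v - s (d v)) = 0
    rw [map_sub, h1, sub_self]
  have h3 := hb _ h2
  rw [map_sub, sub_eq_zero] at h3
  exact h3

omit [FiniteDimensional ℝ E] [T2Space S] in
theorem exists_function_pullback_eq (hp : IsPoissonSubmersion πS πM p) (x : S) (b : CotangentAt E x)
    (hb : ∀ v ∈ verticalSpace E F p x, b v = 0) :
    ∃ f : M → ℝ, ContMDiff 𝓘(ℝ, F) 𝓘(ℝ, ℝ) ∞ f ∧ mvfderiv 𝓘(ℝ, E) (f ∘ p) x = b := by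
  obtain ⟨c, rfl⟩ := exists_pullback_eq hp x b hb
  obtain ⟨f, hf, rfl⟩ := exists_contMDiff_mvfderiv_eq (p x) c
  exact ⟨f, hf, mvfderiv_comp_submersion hp hf x⟩

namespace IsVerticalPartField

variable {πV : BivectorField E S} (h : IsVerticalPartField F πS p πV)
  (hp : IsPoissonSubmersion πS πM p)

include h hp

omit [FiniteDimensional ℝ E] [FiniteDimensional ℝ F] [T2Space S] [T2Space M]

theorem bracket_pullback_left {f : M → ℝ} (hf : ContMDiff 𝓘(ℝ, F) 𝓘(ℝ, ℝ) ∞ f) (g : S → ℝ) :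
    πV.bracket (f ∘ p) g = 0 := by
  funext x
  rw [BivectorField.bracket, BivectorField.hamiltonian,
    (h x).eq_zero _ (mvfderiv_comp_submersion_apply_vertical hp hf x)]
  simp

theorem bracket_pullback_right {f : M → ℝ} (hf : ContMDiff 𝓘(ℝ, F) 𝓘(ℝ, ℝ) ∞ f) (g : S → ℝ) :
    πV.bracket g (f ∘ p) = 0 := by
  funext x
  rw [BivectorField.bracket, BivectorField.hamiltonian, πV.skew,
    (h x).eq_zero _ (mvfderiv_comp_submersion_apply_vertical hp hf x)]
  simp

theorem sub_bracket_pullback_left {f : M → ℝ} (hf : ContMDiff 𝓘(ℝ, F) 𝓘(ℝ, ℝ) ∞ f) (g : S → ℝ) :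
    (πS.sub πV).bracket (f ∘ p) g = πS.bracket (f ∘ p) g := by
  funext x
  have := congrFun (h.bracket_pullback_left hp hf g) x
  rw [BivectorField.bracket, BivectorField.hamiltonian] at this ⊢
  rw [BivectorField.bracket, BivectorField.hamiltonian]
  rw [BivectorField.sub_sharp_apply, map_sub, this]
  simp

theorem sub_bracket_pullback_right {f : M → ℝ} (hf : ContMDiff 𝓘(ℝ, F) 𝓘(ℝ, ℝ) ∞ f) (g : S → ℝ) :
    (πS.sub πV).bracket g (f ∘ p) = πS.bracket g (f ∘ p) := by
  funext x
  have := congrFun (h.bracket_pullback_right hp hf g) x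
  rw [BivectorField.bracket, BivectorField.hamiltonian] at this ⊢
  rw [BivectorField.bracket, BivectorField.hamiltonian]
  rw [BivectorField.sub_sharp_apply, map_sub, this]
  simp

omit h in
theorem _root_.bracket_pullback_pullback {f g : M → ℝ} (hf : ContMDiff 𝓘(ℝ, F) 𝓘(ℝ, ℝ) ∞ f)
    (hg : ContMDiff 𝓘(ℝ, F) 𝓘(ℝ, ℝ) ∞ g) :
    πS.bracket (f ∘ p) (g ∘ p) = πM.bracket f g ∘ p := by
  funext x
  rw [BivectorField.bracket, BivectorField.hamiltonian, mvfderiv_comp_submersion hp hf,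
    mvfderiv_comp_submersion hp hg]
  change mvfderiv 𝓘(ℝ, F) g (p x) (mfderiv 𝓘(ℝ, E) 𝓘(ℝ, F) p x (πS.sharp x _)) = _
  rw [hp.poisson]
  rfl

/-- Each bracket in the Jacobiator has a pulled-back entry, since `{f ∘ p, g ∘ p}` is itself pulled
back from the base. On such brackets `πS` and its horizontal part agree, so Jacobi for `πS`
transfers. -/
theorem schouten_sub_pullback (hS : πS.IsPoisson) {f g : M → ℝ} {k : S → ℝ}
    (hf : ContMDiff 𝓘(ℝ, F) 𝓘(ℝ, ℝ) ∞ f) (hg : ContMDiff 𝓘(ℝ, F) 𝓘(ℝ, ℝ) ∞ g)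
    (hk : ContMDiff 𝓘(ℝ, E) 𝓘(ℝ, ℝ) ∞ k) (x : S) :
    BivectorField.schouten (πS.sub πV) (πS.sub πV) (f ∘ p) (g ∘ p) k x = 0 := by
  rw [← hS (f ∘ p) (g ∘ p) k (hf.comp hp.smooth) (hg.comp hp.smooth) hk x]
  unfold BivectorField.schouten
  rw [h.sub_bracket_pullback_left hp hf, bracket_pullback_pullback hp hf hg,
    h.sub_bracket_pullback_left hp (πM.contMDiff_bracket hf hg),
    h.sub_bracket_pullback_left hp hg, h.sub_bracket_pullback_right hp hf,
    h.sub_bracket_pullback_right hp hf, h.sub_bracket_pullback_right hp hg]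

theorem schouten_self_pullback {f : M → ℝ} {g k : S → ℝ}
    (hf : ContMDiff 𝓘(ℝ, F) 𝓘(ℝ, ℝ) ∞ f) (x : S) :
    BivectorField.schouten πV πV (f ∘ p) g k x = 0 := by
  have h0 : ∀ a : S → ℝ, πV.bracket 0 a = 0 := fun a => by
    have := h.bracket_pullback_left hp (f := fun _ => 0) contMDiff_const a
    exact this
  unfold BivectorField.schouten
  rw [h.bracket_pullback_left hp hf, h.bracket_pullback_right hp hf,
    h.bracket_pullback_right hp hf, h0, h0]
  simp

end IsVerticalPartField

/-! ### Points where the rank of the horizontal part is locally maximal -/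

omit [T2Space S] [FiniteDimensional ℝ E] in
open Module in
theorem BivectorField.finrank_range_chartRep (π : BivectorField E S) {x₀ : S} {z : E}
    (hz : z ∈ (extChartAt 𝓘(ℝ, E) x₀).target) :
    finrank ℝ (LinearMap.range (chartRep x₀ π.sharp z).toLinearMap) =
      finrank ℝ (π.image ((extChartAt 𝓘(ℝ, E) x₀).symm z)) := by
  have hy := chart_symm_mem_source hz
  set y := (extChartAt 𝓘(ℝ, E) x₀).symm z with hyz
  have hinj : Function.Injective (chartDeriv E x₀ y).toLinearMap :=
    Function.LeftInverse.injective (g := chartDerivSymm E x₀ y) (chartDerivSymm_chartDeriv hy)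
  have hmap : LinearMap.range (chartRep x₀ π.sharp z).toLinearMap =
      (π.image y).map (chartDeriv E x₀ y).toLinearMap := by
    ext w
    constructor
    · rintro ⟨α, rfl⟩
      exact ⟨_, ⟨α.comp (chartDeriv E x₀ y), rfl⟩, rfl⟩
    · rintro ⟨_, ⟨β, rfl⟩, rfl⟩
      refine ⟨β.comp (chartDerivSymm E x₀ y), ?_⟩
      change chartRep x₀ π.sharp z _ = _
      rw [chartRep_apply, ← hyz, comp_chartDerivSymm_comp_chartDeriv hy]
      rfl
  rw [hmap]
  exact ((π.image y).equivMapOfInjective _ hinj).finrank_eq.symm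

open Module in
/-- The points at which the rank of `π` is locally maximal. -/
def BivectorField.regularPoints (π : BivectorField E S) : Set S :=
  {x | ∀ᶠ y in nhds x, finrank ℝ (π.image y) ≤ finrank ℝ (π.image x)}

omit [T2Space S] in
theorem BivectorField.dense_regularPoints (π : BivectorField E S) : Dense π.regularPoints :=
  dense_setOf_eventually_le _ (Module.finrank ℝ E) fun x => Submodule.finrank_le (π.image x)

omit [T2Space S] in
theorem BivectorField.fderiv_chartRep_apply_ker (π : BivectorField E S) {x : S}
    (hx : x ∈ π.regularPoints) (v : E) (α β : E →L[ℝ] ℝ)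
    (hα : chartRep x π.sharp (extChartAt 𝓘(ℝ, E) x x) α = 0)
    (hβ : chartRep x π.sharp (extChartAt 𝓘(ℝ, E) x x) β = 0) :
    β (fderiv ℝ (chartRep x π.sharp) (extChartAt 𝓘(ℝ, E) x x) v α) = 0 := by
  have hxs := mem_chart_source E x
  refine fderiv_apply_ker_eq_zero_of_rank_le (chartRep x π.sharp) (extChartAt 𝓘(ℝ, E) x x)
    ((π.contDiffAt_chartRep hxs).of_le (by simp)) (π.chartRep_skew _) ?_ v α β hα hβ
  have ht := extChartAt_target_mem_nhds_image hxs
  have hc : Filter.Tendsto (extChartAt 𝓘(ℝ, E) x).symm (nhds (extChartAt 𝓘(ℝ, E) x x))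
      (nhds x) := by
    have := (continuousAt_extChartAt_symm (I := 𝓘(ℝ, E)) x).tendsto
    rwa [extChartAt_to_inv] at this
  filter_upwards [ht, hc hx] with z hz hz'
  rw [π.finrank_range_chartRep hz, π.finrank_range_chartRep (mem_of_mem_nhds ht),
    extChartAt_to_inv]
  exact hz'

/-! ### The Poisson identities for the two parts -/

namespace IsVerticalPartField

variable {πV : BivectorField E S} (h : IsVerticalPartField F πS p πV)
  (hp : IsPoissonSubmersion πS πM p) (hcor : HasCoregularFibres F πS p)

include h hp hcor

omit [T2Space S] [FiniteDimensional ℝ F] [T2Space M] [IsManifold 𝓘(ℝ, F) ∞ M] hp in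
/-- Splitting of covectors in a chart. -/
theorem exists_chart_splitting (x : S) (ξ : E →L[ℝ] ℝ) : ∃ a b : E →L[ℝ] ℝ, ξ = a + b ∧
    chartRep x (πS.sub πV).sharp (extChartAt 𝓘(ℝ, E) x x) a = 0 ∧
      ∀ v ∈ verticalSpace E F p x, b (chartDeriv E x x v) = 0 := by
  have hx := mem_chart_source E x
  obtain ⟨a, b, hab, ha, hb⟩ := exists_covector_splitting (πS.skew x) (hcor.apply_eq_zero x)
    (ξ.comp (chartDeriv E x x))
  refine ⟨a.comp (chartDerivSymm E x x), b.comp (chartDerivSymm E x x), ?_, ?_, ?_⟩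
  · rw [← ContinuousLinearMap.add_comp, ← hab, comp_chartDeriv_comp_chartDerivSymm hx]
  · rw [chartRep_chart_apply _ hx, comp_chartDerivSymm_comp_chartDeriv hx]
    rw [BivectorField.sub_sharp_apply, (h x).eq_of_mem a ha, sub_self, map_zero]
  · intro v hv
    simp [chartDerivSymm_chartDeriv hx, hb v hv]

omit h hcor [T2Space S] [FiniteDimensional ℝ E] in
theorem _root_.exists_function_pullback_chart_eq (x : S) (b : E →L[ℝ] ℝ)
    (hb : ∀ v ∈ verticalSpace E F p x, b (chartDeriv E x x v) = 0) :
    ∃ f : M → ℝ, ContMDiff 𝓘(ℝ, F) 𝓘(ℝ, ℝ) ∞ f ∧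
      fderiv ℝ ((f ∘ p) ∘ (extChartAt 𝓘(ℝ, E) x).symm) (extChartAt 𝓘(ℝ, E) x x) = b := by
  have hx := mem_chart_source E x
  obtain ⟨f, hf, e⟩ := exists_function_pullback_eq hp x (b.comp (chartDeriv E x x)) hb
  refine ⟨f, hf, ?_⟩
  rw [mvfderiv_eq_fderiv_comp_chartDeriv hx _ ((hf.comp hp.smooth) x)] at e
  rw [← comp_chartDeriv_comp_chartDerivSymm hx (fderiv ℝ _ _), e,
    comp_chartDeriv_comp_chartDerivSymm hx]

omit hcor h hp [FiniteDimensional ℝ F] [T2Space M] in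
theorem _root_.exists_function_chart_eq (x : S) (b : E →L[ℝ] ℝ) :
    ∃ f : S → ℝ, ContMDiff 𝓘(ℝ, E) 𝓘(ℝ, ℝ) ∞ f ∧
      fderiv ℝ (f ∘ (extChartAt 𝓘(ℝ, E) x).symm) (extChartAt 𝓘(ℝ, E) x x) = b := by
  have hx := mem_chart_source E x
  obtain ⟨f, hf, e⟩ := exists_contMDiff_mvfderiv_eq x (b.comp (chartDeriv E x x))
  refine ⟨f, hf, ?_⟩
  rw [mvfderiv_eq_fderiv_comp_chartDeriv hx _ (hf x)] at e
  rw [← comp_chartDeriv_comp_chartDerivSymm hx (fderiv ℝ _ _), e,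
    comp_chartDeriv_comp_chartDerivSymm hx]

variable (hS : πS.IsPoisson)

include hS

/-- Three kernel covectors kill every term outright. With two, the one surviving term differentiates
the bivector between kernel covectors and vanishes by maximality of the rank. Two annihilators of
`V` are covered by `schouten_sub_pullback`. -/
theorem schoutenForm_sub_eq_zero (x : S) (hx : x ∈ (πS.sub πV).regularPoints)
    (α β γ : E →L[ℝ] ℝ) :
    schoutenForm (chartRep x (πS.sub πV).sharp) (chartRep x (πS.sub πV).sharp)
      (extChartAt 𝓘(ℝ, E) x x) α β γ = 0 := by
  refine cyclic_trilinear_eq_zero _ (schoutenForm_add_left _ _ _) (schoutenForm_cyclic _ _ _)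
    (fun a => chartRep x (πS.sub πV).sharp (extChartAt 𝓘(ℝ, E) x x) a = 0)
    (fun b => ∀ v ∈ verticalSpace E F p x, b (chartDeriv E x x v) = 0)
    (h.exists_chart_splitting hcor x) ?_ ?_ ?_ α β γ
  · intro a b c ha hb hc
    simp only [schoutenForm, ha, hb, hc, map_zero, zero_apply, add_zero]
  · intro a b c ha hb hc
    simp only [schoutenForm, ha, hb, (πS.sub πV).fderiv_chartRep_apply_ker hx _ a b ha hb, map_zero,
      zero_apply, add_zero]
  · intro a b c ha hb
    obtain ⟨f, hf, rfl⟩ := exists_function_pullback_chart_eq hp x a ha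
    obtain ⟨g, hg, rfl⟩ := exists_function_pullback_chart_eq hp x b hb
    obtain ⟨k, hk, rfl⟩ := exists_function_chart_eq x c
    have := h.schouten_sub_pullback hp hS hf hg hk x
    rwa [BivectorField.schouten_eq_neg_schoutenForm _ _ (mem_chart_source E x)
      (hf.comp hp.smooth) (hg.comp hp.smooth) hk, neg_eq_zero] at this

omit hp hcor h hS [FiniteDimensional ℝ F] [T2Space M] [FiniteDimensional ℝ E] [T2Space S] in
theorem _root_.BivectorField.chartRep_eq_add_sub (πS πV : BivectorField E S) (x : S) :
    chartRep x πS.sharp = chartRep x πV.sharp + chartRep x (πS.sub πV).sharp := by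
  funext z
  refine ContinuousLinearMap.ext fun α => ?_
  rw [Pi.add_apply, add_apply, chartRep_apply, chartRep_apply, chartRep_apply,
    BivectorField.sub_sharp_apply, map_sub]
  abel

/-- Any entry annihilating `V` gives zero, because brackets of `πV` with pulled-back functions
vanish. On three covectors in the kernel of the horizontal part the mixed trivector vanishes at a
regular point, so polarization reduces the claim to Jacobi for `πS` and for the horizontal part. -/
theorem schoutenForm_self_eq_zero (x : S) (hx : x ∈ (πS.sub πV).regularPoints)
    (α β γ : E →L[ℝ] ℝ) :
    schoutenForm (chartRep x πV.sharp) (chartRep x πV.sharp)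
      (extChartAt 𝓘(ℝ, E) x x) α β γ = 0 := by
  have hxs := mem_chart_source E x
  have hW : ∀ a b c : E →L[ℝ] ℝ, (∀ v ∈ verticalSpace E F p x, a (chartDeriv E x x v) = 0) →
      schoutenForm (chartRep x πV.sharp) (chartRep x πV.sharp) (extChartAt 𝓘(ℝ, E) x x) a b c = 0 := by
    intro a b c ha
    obtain ⟨f, hf, rfl⟩ := exists_function_pullback_chart_eq hp x a ha
    obtain ⟨g, hg, rfl⟩ := exists_function_chart_eq x b
    obtain ⟨k, hk, rfl⟩ := exists_function_chart_eq x c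
    have := h.schouten_self_pullback hp hf (g := g) (k := k) x
    rwa [BivectorField.schouten_eq_neg_schoutenForm _ _ (mem_chart_source E x)
      (hf.comp hp.smooth) hg hk, neg_eq_zero] at this
  refine cyclic_trilinear_eq_zero _ (schoutenForm_add_left _ _ _) (schoutenForm_cyclic _ _ _)
    (fun a => chartRep x (πS.sub πV).sharp (extChartAt 𝓘(ℝ, E) x x) a = 0)
    (fun b => ∀ v ∈ verticalSpace E F p x, b (chartDeriv E x x v) = 0)
    (h.exists_chart_splitting hcor x) ?_ ?_ (fun a b c ha _ => hW a b c ha) α β γ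
  · intro a b c ha hb hc
    have h1 := schoutenForm_add_self (chartRep x πV.sharp) (chartRep x (πS.sub πV).sharp)
      (extChartAt 𝓘(ℝ, E) x x)
      (Filter.EventuallyEq.of_eq (BivectorField.chartRep_eq_add_sub πS πV x))
      ((πV.contDiffAt_chartRep hxs).differentiableAt (by simp))
      (((πS.sub πV).contDiffAt_chartRep hxs).differentiableAt (by simp)) a b c
    rw [hS.schoutenForm_eq_zero hxs, h.schoutenForm_sub_eq_zero hp hcor hS x hx] at h1
    have h2 : schoutenForm (chartRep x πV.sharp) (chartRep x (πS.sub πV).sharp)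
        (extChartAt 𝓘(ℝ, E) x x) a b c = 0 := by
      simp only [schoutenForm, ha, hb, hc, map_zero, zero_apply, add_zero, (πS.sub πV).fderiv_chartRep_apply_ker hx _ a b ha hb,
        (πS.sub πV).fderiv_chartRep_apply_ker hx _ b c hb hc,
        (πS.sub πV).fderiv_chartRep_apply_ker hx _ c a hc ha]
    rw [h2] at h1
    linarith
  · intro a b c ha hb hc
    rw [← schoutenForm_cyclic]
    exact hW _ _ _ hc

theorem isPoisson_sub : (πS.sub πV).IsPoisson := by
  intro f g k hf hg hk x
  refine congrFun ((BivectorField.continuous_schouten _ _ hf hg hk).ext_on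
    (πS.sub πV).dense_regularPoints continuous_const fun y hy => ?_) x
  rw [BivectorField.schouten_eq_neg_schoutenForm _ _ (mem_chart_source E y) hf hg hk,
    h.schoutenForm_sub_eq_zero hp hcor hS y hy, neg_zero]

theorem isPoisson : πV.IsPoisson := by
  intro f g k hf hg hk x
  refine congrFun ((BivectorField.continuous_schouten _ _ hf hg hk).ext_on
    (πS.sub πV).dense_regularPoints continuous_const fun y hy => ?_) x
  rw [BivectorField.schouten_eq_neg_schoutenForm _ _ (mem_chart_source E y) hf hg hk,
    h.schoutenForm_self_eq_zero hp hcor hS y hy, neg_zero]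

theorem commute_sub : πV.Commute (πS.sub πV) := by
  intro f g k hf hg hk x
  have hxs := mem_chart_source E x
  rw [BivectorField.schouten_eq_neg_schoutenForm _ _ hxs hf hg hk]
  have h1 := schoutenForm_add_self (chartRep x πV.sharp) (chartRep x (πS.sub πV).sharp)
    (extChartAt 𝓘(ℝ, E) x x)
    (Filter.EventuallyEq.of_eq (BivectorField.chartRep_eq_add_sub πS πV x))
    ((πV.contDiffAt_chartRep hxs).differentiableAt (by simp))
    (((πS.sub πV).contDiffAt_chartRep hxs).differentiableAt (by simp))
    (fderiv ℝ (f ∘ (extChartAt 𝓘(ℝ, E) x).symm) (extChartAt 𝓘(ℝ, E) x x))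
    (fderiv ℝ (g ∘ (extChartAt 𝓘(ℝ, E) x).symm) (extChartAt 𝓘(ℝ, E) x x))
    (fderiv ℝ (k ∘ (extChartAt 𝓘(ℝ, E) x).symm) (extChartAt 𝓘(ℝ, E) x x))
  rw [hS.schoutenForm_eq_zero hxs, (h.isPoisson hp hcor hS).schoutenForm_eq_zero hxs,
    (h.isPoisson_sub hp hcor hS).schoutenForm_eq_zero hxs] at h1
  linarith

end IsVerticalPartField

end Splitting

section Characterizations

variable {E : Type*} [NormedAddCommGroup E] [NormedSpace ℝ E] [FiniteDimensional ℝ E]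
  {S : Type*} [TopologicalSpace S] [ChartedSpace E S] [IsManifold 𝓘(ℝ, E) ∞ S]
  {F : Type*} [NormedAddCommGroup F] [NormedSpace ℝ F]
  {M : Type*} [TopologicalSpace M] [ChartedSpace F M]
  {πS : BivectorField E S} {p : S → M}

/-! ### Orthogonal pencils -/

theorem IsOrthogonalPencil.exists_isVerticalPartField (h : IsOrthogonalPencil F πS p) :
    ∃ πV : BivectorField E S, IsVerticalPartField F πS p πV := by
  obtain ⟨πV, πH, -, -, -, hadd, hV, hH⟩ := h
  refine ⟨πV, fun x => IsVerticalPart.of_add (H := πH.sharp x) (πS.skew x) (πV.skew x) (hadd x)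
    (fun η => hV x ⟨η, rfl⟩) fun η hη => ?_⟩
  have h : πH.sharp x η ∈ πH.image x ⊓ verticalSpace E F p x := ⟨⟨η, rfl⟩, hη⟩
  rwa [hH x, Submodule.mem_bot] at h

theorem IsVerticalPartField.isVertical {πV : BivectorField E S}
    (h : IsVerticalPartField F πS p πV) (hcor : HasCoregularFibres F πS p) :
    IsVertical F πV p := by
  rintro x _ ⟨η, rfl⟩
  exact (h x).apply_mem (πS.skew x) (hcor.apply_eq_zero x) η

theorem IsVerticalPartField.image_sub_inf_eq_bot {πV : BivectorField E S}
    (h : IsVerticalPartField F πS p πV) (hcor : HasCoregularFibres F πS p) (x : S) :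
    (πS.sub πV).image x ⊓ verticalSpace E F p x = ⊥ := by
  rw [eq_bot_iff]
  rintro _ ⟨⟨η, rfl⟩, hη⟩
  exact (Submodule.mem_bot ℝ).2
    ((h x).sub_apply_eq_zero_of_mem (πS.skew x) (hcor.apply_eq_zero x) η hη)

/-! ### Symplectic leaves -/

/-- A bivector is determined by its characteristic subspace and the form on it, and here both are
those of the horizontal part of `πS`. -/
theorem HasHorizontalLeaves.isVerticalPartField {πH : BivectorField E S}
    (h : HasHorizontalLeaves F πS p πH) : IsVerticalPartField F πS p (πS.sub πH) := by
  intro x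
  obtain ⟨-, him, hform⟩ := h x
  have hr : ∀ w, (∃ η, πH.sharp x η = w) ↔
      ∃ b : CotangentAt E x, (∀ v ∈ verticalSpace E F p x, b v = 0) ∧ πS.sharp x b = w := by
    intro w
    exact SetLike.ext_iff.1 him w
  refine IsVerticalPart.of_form (πS.skew x) (πH.skew x) hr ?_
  intro ζ η b b' hb hb' e e'
  have h1 := hform (πS.sharp x b) ⟨b, hb, rfl⟩ (πS.sharp x b') ⟨b', hb', rfl⟩
  rw [πS.leafForm_sharp] at h1
  rw [← h1, ← e, ← e', πH.leafForm_sharp]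

namespace IsVerticalPartField

variable {πV : BivectorField E S} (h : IsVerticalPartField F πS p πV)
  (hcor : HasCoregularFibres F πS p)

include h hcor

theorem image_sub (x : S) : (πS.sub πV).image x = horizontalSpace F πS p x := by
  ext w
  exact (h x).range_sub (πS.skew x) (hcor.apply_eq_zero x) w

omit hcor [FiniteDimensional ℝ E] in
theorem leafForm_sub (x : S) (u v : TangentSpace 𝓘(ℝ, E) x) (hu : u ∈ horizontalSpace F πS p x)
    (hv : v ∈ horizontalSpace F πS p x) :
    (πS.sub πV).leafForm x u v = πS.leafForm x u v := by
  obtain ⟨b, hb, rfl⟩ := hu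
  obtain ⟨c, hc, rfl⟩ := hv
  have key : ∀ b ∈ verticalAnnihilator E F p x, (πS.sub πV).sharp x b = πS.sharp x b := by
    intro b hb
    rw [BivectorField.sub_sharp_apply, (h x).eq_zero b hb, sub_zero]
  change (πS.sub πV).leafForm x (πS.sharp x b) (πS.sharp x c) =
    πS.leafForm x (πS.sharp x b) (πS.sharp x c)
  rw [πS.leafForm_sharp, ← key b hb, ← key c hc, BivectorField.leafForm_sharp]

/-! ### Poisson structures on the fibres -/

theorem fibrePoissonAssembleTo : FibrePoissonAssembleTo F πS p πV := by
  intro x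
  set V := verticalSpace E F p x with hV
  obtain ⟨P, hP⟩ := V.exists_isCompl
  let q : TangentSpace 𝓘(ℝ, E) x →L[ℝ] V := LinearMap.toContinuousLinearMap (V.projectionOnto P hP)
  have hq : ∀ v : V, q v = v := fun v => Submodule.projectionOnto_apply_left hP v
  have hmem := (h x).apply_mem (πS.skew x) (hcor.apply_eq_zero x)
  -- `πV♯` kills the annihilator of `V`, so it sees only the restriction of a covector to `V`; the
  -- choice of the complement `P` does not matter.
  have hext : ∀ ξ : CotangentAt E x, πV.sharp x ((ξ.comp V.subtypeL).comp q) = πV.sharp x ξ := by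
    intro ξ
    rw [← sub_eq_zero, ← map_sub]
    refine (h x).eq_zero _ fun v hv => ?_
    have := hq ⟨v, hv⟩
    simp only at this
    simp [this]
  refine ⟨((πV.sharp x).comp (ContinuousLinearMap.precomp ℝ q)).codRestrict V
    fun η => hmem _, ?_, fun ξ => ?_⟩
  · intro u η
    constructor
    · intro hu
      have hu' : (u : TangentSpace 𝓘(ℝ, E) x) = πV.sharp x (η.comp q) := congrArg Subtype.val hu
      obtain ⟨a, b, hab, ha, hb⟩ := exists_covector_splitting (πS.skew x) (hcor.apply_eq_zero x)
        (η.comp q)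
      refine ⟨a, ?_, ⟨a, ?_⟩⟩
      · ext v
        have h1 : η (q v) = a v + b v := congrArg (fun L => L (v : TangentSpace 𝓘(ℝ, E) x)) hab
        rw [hq, hb v v.2, add_zero] at h1
        simpa using h1
      · rw [hu', hab, map_add, (h x).eq_of_mem a ha, (h x).eq_zero b hb, add_zero]
        rfl
    · rintro ⟨ξ, rfl, ξ', hξ⟩
      have h1 : ξ' = ξ := congrArg Prod.snd hξ
      have h2 : πS.sharp x ξ' = u := congrArg Prod.fst hξ
      subst h1
      apply Subtype.ext
      change (u : TangentSpace 𝓘(ℝ, E) x) = πV.sharp x ((ξ'.comp V.subtypeL).comp q)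
      rw [hext, (h x).eq_of_mem ξ' (by rw [h2]; exact u.2), h2]
  · exact (hext ξ).symm

end IsVerticalPartField

omit [FiniteDimensional ℝ E] in
theorem FibrePoissonAssembleTo.isVerticalPartField {πV : BivectorField E S}
    (h : FibrePoissonAssembleTo F πS p πV) : IsVerticalPartField F πS p πV := by
  intro x
  obtain ⟨ρ, hρ, hV⟩ := h x
  refine ⟨fun a ha => ?_, fun b hb => ?_⟩
  · have := (hρ ⟨_, ha⟩ (a.comp (verticalSpace E F p x).subtypeL)).2 ⟨a, rfl, a, rfl⟩
    rw [hV, ← this]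
  · have h0 : b.comp (verticalSpace E F p x).subtypeL = 0 := by
      ext v
      exact hb v v.2
    rw [hV, h0, map_zero]
    rfl

/-! ### The Dirac family -/

/-- The family is the graph of `B`: its first summand is the graph over the covectors that `πS♯`
sends into `V`, its second is the graph of zero over `V°`, and these covectors together span. -/
theorem IsVerticalPart.mem_verticalDiracFamily (hcor : HasCoregularFibres F πS p) {x : S}
    {B : CotangentAt E x →L[ℝ] TangentSpace 𝓘(ℝ, E) x}
    (h : IsVerticalPart (verticalSpace E F p x) (πS.sharp x) B)
    (w : TangentSpace 𝓘(ℝ, E) x × CotangentAt E x) :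
    w ∈ verticalDiracFamily F πS p x ↔ w.1 = B w.2 := by
  constructor
  · intro hw
    obtain ⟨_, ⟨⟨a, rfl⟩, ha⟩, ⟨v, b⟩, ⟨hv, hb⟩, rfl⟩ := Submodule.mem_sup.1 hw
    have hv0 : v = 0 := hv
    have ha' : πS.sharp x a ∈ verticalSpace E F p x := ha.1
    change πS.sharp x a + v = B (a + b)
    rw [hv0, map_add, h.eq_of_mem a ha', h.eq_zero b hb]
  · obtain ⟨u, ξ⟩ := w
    intro hu
    have hu' : u = B ξ := hu
    subst hu'
    obtain ⟨a, b, rfl, ha, hb⟩ := exists_covector_splitting (πS.skew x) (hcor.apply_eq_zero x) ξ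
    have h1 : B (a + b) = πS.sharp x a := by
      rw [map_add, h.eq_of_mem a ha, h.eq_zero b hb, add_zero]
    refine Submodule.mem_sup.2 ⟨(πS.sharp x a, a), ⟨⟨a, rfl⟩, ha, trivial⟩, (0, b),
      ⟨rfl, hb⟩, ?_⟩
    simp [h1]

theorem IsVerticalPartField.verticalDiracFamilyIsBundle {πV : BivectorField E S}
    (h : IsVerticalPartField F πS p πV) (hcor : HasCoregularFibres F πS p) :
    VerticalDiracFamilyIsBundle F πS p := by
  intro x₀ _
  set b := Module.finBasis ℝ (E →L[ℝ] ℝ) with hb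
  refine ⟨(chartAt E x₀).source, (chartAt E x₀).open_source, mem_chart_source E x₀, _,
    fun i y => (πV.sharp y ((b i).comp (chartDeriv E x₀ y)), (b i).comp (chartDeriv E x₀ y)), ?_, ?_⟩
  · intro i y hy
    refine ContMDiffAt.contMDiffWithinAt ?_
    rw [contMDiffAt_prod_section_iff hy]
    have h1 : ContDiffAt ℝ ∞ (fun z => (chartRep x₀ πV.sharp z (b i), b i))
        (extChartAt 𝓘(ℝ, E) x₀ y) :=
      ((πV.contDiffAt_chartRep hy).clm_apply contDiffAt_const).prodMk contDiffAt_const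
    refine h1.congr_of_eventuallyEq ?_
    filter_upwards [extChartAt_target_mem_nhds_image hy] with z hz
    exact Prod.ext rfl (comp_chartDeriv_comp_chartDerivSymm (chart_symm_mem_source hz) (b i))
  · rintro y ⟨hy, -⟩
    let L : (E →L[ℝ] ℝ) →ₗ[ℝ] TangentSpace 𝓘(ℝ, E) y × CotangentAt E y :=
      ((πV.sharp y).toLinearMap.prod LinearMap.id) ∘ₗ
        (ContinuousLinearMap.precomp ℝ (chartDeriv E x₀ y)).toLinearMap
    have hLinj : Function.Injective L := by
      intro α β hαβ
      have h1 : α.comp (chartDeriv E x₀ y) = β.comp (chartDeriv E x₀ y) := congrArg Prod.snd hαβ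
      rw [← comp_chartDeriv_comp_chartDerivSymm hy α, h1, comp_chartDeriv_comp_chartDerivSymm hy]
    have hLr : LinearMap.range L = verticalDiracFamily F πS p y := by
      ext ⟨u, ξ⟩
      rw [(h y).mem_verticalDiracFamily hcor]
      constructor
      · rintro ⟨α, hα⟩
        have h1 : α.comp (chartDeriv E x₀ y) = ξ := congrArg Prod.snd hα
        have h2 : πV.sharp y (α.comp (chartDeriv E x₀ y)) = u := congrArg Prod.fst hα
        rw [← h2, h1]
      · intro hu
        refine ⟨ξ.comp (chartDerivSymm E x₀ y), ?_⟩
        change (πV.sharp y ((ξ.comp (chartDerivSymm E x₀ y)).comp (chartDeriv E x₀ y)),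
          (ξ.comp (chartDerivSymm E x₀ y)).comp (chartDeriv E x₀ y)) = (u, ξ)
        rw [comp_chartDerivSymm_comp_chartDeriv hy]
        exact Prod.ext hu.symm rfl
    refine ⟨b.linearIndependent.map' L (LinearMap.ker_eq_bot.2 hLinj), ?_⟩
    have h1 : (Set.range fun i => L (b i)) = L '' Set.range b := by
      rw [← Set.range_comp]; rfl
    change Submodule.span ℝ (Set.range fun i => L (b i)) = _
    rw [h1, Submodule.span_image, b.span_eq, Submodule.map_top, hLr]

/-- A local frame of the graph of `B` consists of pairs `(B ξᵢ, ξᵢ)`. The `ξᵢ` form a coframe, so in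
a chart `B` is recovered as `Υ ∘ Ξ⁻¹`, which is smooth since inversion of linear maps is. -/
theorem VerticalDiracFamilyIsBundle.exists_isVerticalPartField
    (h : VerticalDiracFamilyIsBundle F πS p) (hcor : HasCoregularFibres F πS p) :
    ∃ πV : BivectorField E S, IsVerticalPartField F πS p πV := by
  choose B hB using fun x => exists_isVerticalPart (πS.skew x) (hcor.apply_eq_zero x)
  refine ⟨⟨B, fun x => (hB x).skew (πS.skew x) (hcor.apply_eq_zero x), ?_⟩, hB⟩
  intro x₀
  have hx₀ := mem_chart_source E x₀
  rw [contMDiffAt_bivector_iff hx₀]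
  obtain ⟨U, hU, hxU, k, s, hs, hspan⟩ := h x₀ trivial
  set e := extChartAt 𝓘(ℝ, E) x₀ with he
  have hgraph : ∀ y ∈ U, ∀ i, (s i y).1 = B y (s i y).2 := fun y hy i => by
    rw [← (hB y).mem_verticalDiracFamily hcor, ← (hspan y ⟨hy, trivial⟩).2]
    exact Submodule.subset_span ⟨i, rfl⟩
  -- the frame in the chart
  set u : Fin k → E → E := fun i z => chartDeriv E x₀ (e.symm z) (s i (e.symm z)).1 with hu
  set ξ : Fin k → E → (E →L[ℝ] ℝ) :=
    fun i z => (s i (e.symm z)).2.comp (chartDerivSymm E x₀ (e.symm z)) with hξ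
  have hsm : ∀ i, ContDiffAt ℝ ∞ (fun z => (u i z, ξ i z)) (e x₀) := fun i =>
    (contMDiffAt_prod_section_iff hx₀ (s i)).1 ((hs i).contMDiffAt (hU.mem_nhds hxU))
  have hus : ∀ i, ContDiffAt ℝ ∞ (u i) (e x₀) := fun i => (hsm i).fst
  have hξs : ∀ i, ContDiffAt ℝ ∞ (ξ i) (e x₀) := fun i => (hsm i).snd
  set Ξ : E → (Fin k → ℝ) →L[ℝ] (E →L[ℝ] ℝ) := fun z =>
    ∑ i, (ContinuousLinearMap.proj (R := ℝ) (φ := fun _ : Fin k => ℝ) i).smulRight (ξ i z) with hΞ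
  set Υ : E → (Fin k → ℝ) →L[ℝ] E := fun z =>
    ∑ i, (ContinuousLinearMap.proj (R := ℝ) (φ := fun _ : Fin k => ℝ) i).smulRight (u i z) with hΥ
  have hΞs : ContDiffAt ℝ ∞ Ξ (e x₀) :=
    ContDiffAt.sum fun i _ => contDiffAt_const.smulRight (hξs i)
  have hΥs : ContDiffAt ℝ ∞ Υ (e x₀) :=
    ContDiffAt.sum fun i _ => contDiffAt_const.smulRight (hus i)
  have hΞa : ∀ z c, Ξ z c = ∑ i, c i • ξ i z := fun z c => by simp [hΞ]
  have hΥa : ∀ z c, Υ z c = ∑ i, c i • u i z := fun z c => by simp [hΥ]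
  have hnear : ∀ᶠ z in nhds (e x₀), z ∈ e.target ∧ e.symm z ∈ U := by
    have hc : Filter.Tendsto e.symm (nhds (e x₀)) (nhds x₀) := by
      have := (continuousAt_extChartAt_symm (I := 𝓘(ℝ, E)) x₀).tendsto
      rwa [extChartAt_to_inv] at this
    exact Filter.Eventually.and (extChartAt_target_mem_nhds_image hx₀) (hc (hU.mem_nhds hxU))
  have hrep : ∀ z, z ∈ e.target ∧ e.symm z ∈ U → ∀ c, Υ z c = chartRep x₀ B z (Ξ z c) := by
    rintro z ⟨hz, hzU⟩ c
    rw [hΞa, hΥa, map_sum]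
    refine Finset.sum_congr rfl fun i _ => ?_
    rw [map_smul, chartRep_apply, hξ]
    simp only
    rw [comp_chartDerivSymm_comp_chartDeriv (chart_symm_mem_source hz), hu]
    simp only
    rw [hgraph _ hzU]
  obtain ⟨hy0, hy0U⟩ := hnear.self_of_nhds
  replace hy0 := chart_symm_mem_source hy0
  -- On a graph, a linear relation among the covectors forces the same relation among the vectors,
  -- contradicting independence of the frame.
  have hinj : Function.Injective (Ξ (e x₀)) := by
    rw [injective_iff_map_eq_zero]
    intro c hc
    have h2 := hrep (e x₀) hnear.self_of_nhds c
    rw [hc, map_zero, hΥa] at h2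
    rw [hΞa] at hc
    have hlin := (hspan _ ⟨hy0U, trivial⟩).1
    rw [Fintype.linearIndependent_iff] at hlin
    refine funext (hlin c (Prod.ext ?_ ?_))
    · rw [Prod.fst_sum]
      have h3 : chartDeriv E x₀ (e.symm (e x₀)) (∑ i, c i • (s i (e.symm (e x₀))).1) = 0 := by
        rw [map_sum, ← h2]
        exact Finset.sum_congr rfl fun i _ => map_smul _ _ _
      have h4 := congrArg (chartDerivSymm E x₀ (e.symm (e x₀))) h3
      rw [chartDerivSymm_chartDeriv hy0, map_zero] at h4
      exact h4
    · rw [Prod.snd_sum]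
      have h3 : (∑ i, c i • (s i (e.symm (e x₀))).2).comp
          (chartDerivSymm E x₀ (e.symm (e x₀))) = 0 := by
        rw [← hc, ContinuousLinearMap.finsetSum_comp]
        rfl
      have h4 := comp_chartDerivSymm_comp_chartDeriv hy0 (∑ i, c i • (s i (e.symm (e x₀))).2)
      rw [h3, ContinuousLinearMap.zero_comp] at h4
      exact h4.symm
  have hsurj : Function.Surjective (Ξ (e x₀)) := by
    intro α
    have h2 : (B (e.symm (e x₀)) (α.comp (chartDeriv E x₀ (e.symm (e x₀)))),
        α.comp (chartDeriv E x₀ (e.symm (e x₀)))) ∈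
        Submodule.span ℝ (Set.range fun i => s i (e.symm (e x₀))) := by
      rw [(hspan _ ⟨hy0U, trivial⟩).2, (hB _).mem_verticalDiracFamily hcor]
    obtain ⟨c, hc⟩ := (Submodule.mem_span_range_iff_exists_fun ℝ).1 h2
    refine ⟨c, ?_⟩
    have h3 : ∑ i, c i • (s i (e.symm (e x₀))).2 =
        α.comp (chartDeriv E x₀ (e.symm (e x₀))) := by
      have := congrArg Prod.snd hc
      rwa [Prod.snd_sum] at this
    rw [hΞa, ← comp_chartDeriv_comp_chartDerivSymm hy0 α, ← h3,
      ContinuousLinearMap.finsetSum_comp]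
    rfl
  set Ξ₀ : (Fin k → ℝ) ≃L[ℝ] (E →L[ℝ] ℝ) :=
    (LinearEquiv.ofBijective (Ξ (e x₀)).toLinearMap ⟨hinj, hsurj⟩).toContinuousLinearEquiv with hΞ₀
  have hΞe : Ξ (e x₀) = (Ξ₀ : (Fin k → ℝ) →L[ℝ] (E →L[ℝ] ℝ)) := by
    ext c
    rfl
  have hinv : ContDiffAt ℝ ∞ (fun z => (Ξ z).inverse) (e x₀) := by
    have := contDiffAt_map_inverse (𝕜 := ℝ) (n := ∞) Ξ₀
    rw [← hΞe] at this
    exact this.comp (e x₀) hΞs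
  refine (hΥs.clm_comp hinv).congr_of_eventuallyEq ?_
  have hopen := ContinuousLinearEquiv.nhds Ξ₀
  rw [← hΞe] at hopen
  filter_upwards [hΞs.continuousAt hopen, hnear] with z hz hz'
  obtain ⟨φ, hφ⟩ := hz
  refine ContinuousLinearMap.ext fun α => ?_
  rw [ContinuousLinearMap.comp_apply, hrep z hz', ← hφ, ContinuousLinearMap.inverse_equiv]
  simp

end Characterizations

/-! ## Hamiltonian curves and leaves -/

/-- Integral curves of smooth time-dependent vector fields are smooth. -/
theorem contDiffWithinAt_of_hasDerivWithinAt {E : Type*} [NormedAddCommGroup E] [NormedSpace ℝ E]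
    {c : ℝ → E} {w : ℝ → E → E} {s : Set ℝ} {t₀ : ℝ}
    (hw : ContDiffAt ℝ ∞ (Function.uncurry w) (t₀, c t₀)) (ht : t₀ ∈ s)
    (hc : ∀ᶠ t in nhdsWithin t₀ s, HasDerivWithinAt c (w t (c t)) s t) :
    ContDiffWithinAt ℝ ∞ c s t₀ := by
  rw [contDiffWithinAt_infty]
  intro n
  -- Bootstrapping: if `c` is `C^n`, so is its derivative `w t (c t)`, hence `c` is `C^(n+1)`.
  induction n with
  | zero =>
    rw [Nat.cast_zero, contDiffWithinAt_zero ht]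
    exact ⟨_, hc, fun t ht' => ht'.2.continuousWithinAt.mono Set.inter_subset_left⟩
  | succ n ih =>
    rw [Nat.cast_add, Nat.cast_one, contDiffWithinAt_succ_iff_hasFDerivWithinAt' (by simp)]
    refine ⟨s ∩ {t | HasDerivWithinAt c (w t (c t)) s t}, ?_, ?_, ?_,
      fun t => (1 : ℝ →L[ℝ] ℝ).smulRight (w t (c t)), ?_, ?_⟩
    · rw [Set.insert_eq_of_mem ht]
      exact Filter.inter_mem self_mem_nhdsWithin hc
    · rw [Set.insert_eq_of_mem ht]
      exact Set.inter_subset_left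
    · intro h
      simp at h
    · exact fun t ht' => ht'.2.hasFDerivWithinAt
    · have h1 : ContDiffWithinAt ℝ n (fun t => (t, c t)) s t₀ := contDiffWithinAt_id.prodMk ih
      have h2 : ContDiffWithinAt ℝ n (fun t => w t (c t)) s t₀ :=
        ((hw.of_le (by exact_mod_cast le_top) :
          ContDiffAt ℝ n (Function.uncurry w) (t₀, c t₀))).comp_contDiffWithinAt
            (f := fun t => (t, c t)) t₀ h1
      exact contDiffWithinAt_const.smulRight h2

section IntegralCurves

variable {E : Type*} [NormedAddCommGroup E] [NormedSpace ℝ E]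
  {M : Type*} [TopologicalSpace M] [ChartedSpace E M] [IsManifold 𝓘(ℝ, E) ∞ M]

theorem contDiffAt_comp_chart_symm_prod {g : M × ℝ → ℝ}
    (hg : ContMDiff (𝓘(ℝ, E).prod 𝓘(ℝ, ℝ)) 𝓘(ℝ, ℝ) ∞ g) {x₀ : M} {z : E}
    (hz : z ∈ (extChartAt 𝓘(ℝ, E) x₀).target) (t : ℝ) :
    ContDiffAt ℝ ∞ (fun q : E × ℝ => g ((extChartAt 𝓘(ℝ, E) x₀).symm q.1, q.2)) (z, t) := by
  have h1 : ContMDiffAt 𝓘(ℝ, E) 𝓘(ℝ, E) ∞ (extChartAt 𝓘(ℝ, E) x₀).symm z :=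
    (contMDiffOn_extChartAt_symm x₀).contMDiffAt ((isOpen_extChartAt_target x₀).mem_nhds hz)
  rw [← contMDiffAt_iff_contDiffAt]
  have h2 : ContMDiffAt 𝓘(ℝ, E × ℝ) (𝓘(ℝ, E).prod 𝓘(ℝ, ℝ)) ∞
      (fun q : E × ℝ => ((extChartAt 𝓘(ℝ, E) x₀).symm q.1, q.2)) (z, t) :=
    (ContMDiffAt.comp (z, t) h1 contDiffAt_fst.contMDiffAt).prodMk contDiffAt_snd.contMDiffAt
  exact (hg _).comp (z, t) h2

omit [IsManifold 𝓘(ℝ, E) ∞ M] in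
theorem contMDiff_slice {g : M × ℝ → ℝ}
    (hg : ContMDiff (𝓘(ℝ, E).prod 𝓘(ℝ, ℝ)) 𝓘(ℝ, ℝ) ∞ g) (t : ℝ) :
    ContMDiff 𝓘(ℝ, E) 𝓘(ℝ, ℝ) ∞ (fun x => g (x, t)) :=
  hg.comp (contMDiff_id.prodMk contMDiff_const)

/-- The differential in the chart at `x₀` of a time-dependent function. -/
noncomputable def chartDifferential (g : M × ℝ → ℝ) (x₀ : M) (t : ℝ) (z : E) : E →L[ℝ] ℝ :=
  fderiv ℝ (fun z' => g ((extChartAt 𝓘(ℝ, E) x₀).symm z', t)) z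

theorem contDiffAt_chartDifferential {g : M × ℝ → ℝ}
    (hg : ContMDiff (𝓘(ℝ, E).prod 𝓘(ℝ, ℝ)) 𝓘(ℝ, ℝ) ∞ g) {x₀ : M} {z : E}
    (hz : z ∈ (extChartAt 𝓘(ℝ, E) x₀).target) (t : ℝ) :
    ContDiffAt ℝ ∞ (Function.uncurry (chartDifferential (E := E) g x₀)) (t, z) := by
  refine ContDiffAt.fderiv (n := ∞)
    (f := fun (q : ℝ × E) z' => g ((extChartAt 𝓘(ℝ, E) x₀).symm z', q.1)) ?_ contDiffAt_snd (by simp)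
  exact ContDiffAt.comp (f := fun r : (ℝ × E) × E => (r.2, r.1.1)) ((t, z), z)
    (contDiffAt_comp_chart_symm_prod hg hz t) (by fun_prop)

theorem BivectorField.chartDeriv_hamiltonian (π : BivectorField E M) {g : M × ℝ → ℝ}
    (hg : ContMDiff (𝓘(ℝ, E).prod 𝓘(ℝ, ℝ)) 𝓘(ℝ, ℝ) ∞ g) {x₀ y : M}
    (hy : y ∈ (chartAt E x₀).source) (t : ℝ) :
    chartDeriv E x₀ y (π.hamiltonian (fun x => g (x, t)) y) =
      chartRep x₀ π.sharp (extChartAt 𝓘(ℝ, E) x₀ y)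
        (chartDifferential g x₀ t (extChartAt 𝓘(ℝ, E) x₀ y)) := by
  rw [hamiltonian, chartRep_chart_apply _ hy,
    mvfderiv_eq_fderiv_comp_chartDeriv hy _ (contMDiff_slice hg t y)]
  rfl

theorem HasMFDerivWithinAt.hasDerivWithinAt_chart {γ : ℝ → M} {s : Set ℝ} {t : ℝ}
    {v : TangentSpace 𝓘(ℝ, E) (γ t)} {x₀ : M}
    (hγ : HasMFDerivWithinAt 𝓘(ℝ, ℝ) 𝓘(ℝ, E) γ s t ((1 : ℝ →L[ℝ] ℝ).smulRight v))
    (hy : γ t ∈ (chartAt E x₀).source) :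
    HasDerivWithinAt (fun t => extChartAt 𝓘(ℝ, E) x₀ (γ t)) (chartDeriv E x₀ (γ t) v) s t := by
  have h1 := (mdifferentiableAt_extChartAt (I := 𝓘(ℝ, E)) hy).hasMFDerivAt
  have h2 := h1.comp_hasMFDerivWithinAt t hγ
  rw [hasMFDerivWithinAt_iff_hasFDerivWithinAt] at h2
  rw [chartDeriv_eq_mfderiv hy]
  generalize mfderiv 𝓘(ℝ, E) 𝓘(ℝ, E) (extChartAt 𝓘(ℝ, E) x₀) (γ t) = A at h2 ⊢
  have key : ∀ (A : E →L[ℝ] E) (v : E) (c : ℝ → E),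
      HasFDerivWithinAt c (A.comp ((1 : ℝ →L[ℝ] ℝ).smulRight v)) s t →
      HasDerivWithinAt c (A v) s t := fun A v c h => by
    simpa using h.hasDerivWithinAt
  exact key A v _ h2

theorem contDiffWithinAt_chart_of_hamiltonian (π : BivectorField E M) {g : M × ℝ → ℝ}
    (hg : ContMDiff (𝓘(ℝ, E).prod 𝓘(ℝ, ℝ)) 𝓘(ℝ, ℝ) ∞ g) {γ : ℝ → M} {s : Set ℝ}
    (hγ : ∀ t ∈ s, HasMFDerivWithinAt 𝓘(ℝ, ℝ) 𝓘(ℝ, E) γ s t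
      ((1 : ℝ →L[ℝ] ℝ).smulRight (π.hamiltonian (fun y => g (y, t)) (γ t))))
    {x₀ : M} {t₀ : ℝ} (ht₀ : t₀ ∈ s) (hy : γ t₀ ∈ (chartAt E x₀).source) :
    ContDiffWithinAt ℝ ∞ (fun t => extChartAt 𝓘(ℝ, E) x₀ (γ t)) s t₀ := by
  have hz := (extChartAt 𝓘(ℝ, E) x₀).map_source (x := γ t₀) (by simpa using hy)
  refine contDiffWithinAt_of_hasDerivWithinAt
    (w := fun t z => chartRep x₀ π.sharp z (chartDifferential g x₀ t z)) ?_ ht₀ ?_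
  · exact ContDiffAt.clm_apply (F := E →L[ℝ] ℝ)
      ((π.contDiffAt_chartRep hy).comp (f := fun q : ℝ × E => q.2)
        (t₀, extChartAt 𝓘(ℝ, E) x₀ (γ t₀)) contDiffAt_snd)
      (contDiffAt_chartDifferential hg hz t₀)
  · filter_upwards [(hγ t₀ ht₀).continuousWithinAt.preimage_mem_nhdsWithin
      ((chartAt E x₀).open_source.mem_nhds hy), self_mem_nhdsWithin] with t hts ht
    have := (hγ t ht).hasDerivWithinAt_chart hts
    rwa [π.chartDeriv_hamiltonian hg hts] at this

end IntegralCurves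

/-! ### Horizontal curves stay in the leaves of the horizontal part -/

section Leaves

variable {E : Type*} [NormedAddCommGroup E] [NormedSpace ℝ E] [FiniteDimensional ℝ E]
  {S : Type*} [TopologicalSpace S] [T2Space S] [SecondCountableTopology S]
  [ChartedSpace E S] [IsManifold 𝓘(ℝ, E) ∞ S]
  {F : Type*} [NormedAddCommGroup F] [NormedSpace ℝ F]
  {M : Type*} [TopologicalSpace M] [ChartedSpace F M] [IsManifold 𝓘(ℝ, F) ∞ M]
  {πS : BivectorField E S} {πM : BivectorField F M} {p : S → M}

omit [FiniteDimensional ℝ E] [T2Space S] [SecondCountableTopology S] in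
theorem BivectorField.hamiltonian_congr {π : BivectorField E S} {f g : S → ℝ} {x : S}
    (h : f =ᶠ[nhds x] g) : π.hamiltonian f x = π.hamiltonian g x := by
  rw [hamiltonian, hamiltonian]
  congr 1
  ext v
  exact congrArg (fun L => L v) (h.mfderiv_eq (I := 𝓘(ℝ, E)) (I' := 𝓘(ℝ, ℝ)))

omit [FiniteDimensional ℝ E] [T2Space S] [SecondCountableTopology S] in
theorem IsVerticalPartField.sub_hamiltonian {πV : BivectorField E S}
    (h : IsVerticalPartField F πS p πV) (hp : IsPoissonSubmersion πS πM p) {f : M → ℝ}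
    (hf : ContMDiff 𝓘(ℝ, F) 𝓘(ℝ, ℝ) ∞ f) (x : S) :
    (πS.sub πV).hamiltonian (f ∘ p) x = πS.hamiltonian (f ∘ p) x := by
  rw [BivectorField.hamiltonian, BivectorField.sub_sharp_apply,
    (h x).eq_zero _ (mvfderiv_comp_submersion_apply_vertical hp hf x), sub_zero]
  rfl

/-- The same curve works, since both bivectors give pulled-back functions the same Hamiltonian
vector field. The pullback `f ∘ p` need not have compact support, so it is multiplied by a cutoff
equal to one near the compact curve. -/
theorem IsVerticalPartField.horizontalLeaf_subset_leaf {πV : BivectorField E S}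
    (h : IsVerticalPartField F πS p πV) (hp : IsPoissonSubmersion πS πM p) (x : S) :
    horizontalLeaf F πS p x ⊆ (πS.sub πV).leaf x := by
  rintro x₁ ⟨f, hf, hfc, γ, h0, h1, hγ⟩
  have : LocallyCompactSpace S := Manifold.locallyCompact_of_finiteDimensional 𝓘(ℝ, E)
  have hcont : ContinuousOn γ (Set.Icc 0 1) := fun t ht => (hγ t ht).continuousWithinAt
  have hK : IsCompact (γ '' Set.Icc 0 1) := isCompact_Icc.image_of_continuousOn hcont
  obtain ⟨K, hKc, hKK⟩ := exists_compact_superset hK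
  obtain ⟨χ, hχ1, hχ0, -⟩ := exists_contMDiffMap_one_nhds_of_subset_interior (n := ⊤) 𝓘(ℝ, E)
    hK.isClosed hKK
  refine ⟨fun q => χ q.1 * f (p q.1, q.2), ?_, ?_, γ, h0, h1, fun t ht => ?_⟩
  · exact (χ.contMDiff.comp contMDiff_fst).mul
      (hf.comp ((hp.smooth.comp contMDiff_fst).prodMk contMDiff_snd))
  · refine HasCompactSupport.intro (hKc.prod (hfc.isCompact.image continuous_snd))
      fun q hq => ?_
    by_cases hqK : q.1 ∈ K
    · have : (p q.1, q.2) ∉ tsupport f := fun hmem => hq ⟨hqK, _, hmem, rfl⟩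
      simp [image_eq_zero_of_notMem_tsupport this]
    · simp [hχ0 _ hqK]
  · have hχ := hχ1.filter_mono (nhds_le_nhdsSet (Set.mem_image_of_mem γ ht))
    have hcongr : (fun y => χ y * f (p y, t)) =ᶠ[nhds (γ t)] (fun m => f (m, t)) ∘ p := by
      filter_upwards [hχ] with y hy
      simp [hy]
    have heq : (πS.sub πV).hamiltonian (fun y => χ y * f (p y, t)) (γ t) =
        πS.hamiltonian (fun y => f (p y, t)) (γ t) := by
      rw [BivectorField.hamiltonian_congr hcongr, h.sub_hamiltonian hp (contMDiff_slice hf t)]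
      rfl
    simp only [id]
    rw [heq]
    exact hγ t ht

end Leaves

/-! ## Lifting Hamiltonian curves -/

section LiftingCurves

variable {E : Type*} [NormedAddCommGroup E] [NormedSpace ℝ E]

theorem contDiffAt_fderiv_flip {X Y : Type*} [NormedAddCommGroup X] [NormedSpace ℝ X]
    [NormedAddCommGroup Y] [NormedSpace ℝ Y] {H : E → X →L[ℝ] Y} {z : E}
    (hH : ContDiffAt ℝ ∞ H z) : ContDiffAt ℝ ∞ (fun z => (fderiv ℝ H z).flip) z := by
  let L : (E →L[ℝ] X →L[ℝ] Y) →L[ℝ] X →L[ℝ] E →L[ℝ] Y :=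
    (ContinuousLinearMap.flipₗᵢ ℝ E X Y).toContinuousLinearEquiv.toContinuousLinearMap
  have hL : ContDiff ℝ ∞ L := by fun_prop
  exact hL.contDiffAt.comp z (hH.fderiv_right (m := ∞) (by simp))

theorem fderiv_skew {H : E → (E →L[ℝ] ℝ) →L[ℝ] E}
    (hH : ∀ (z : E) (α β : E →L[ℝ] ℝ), β (H z α) = - α (H z β)) {z : E} (hd : DifferentiableAt ℝ H z) (v : E)
    (α β : E →L[ℝ] ℝ) : β (fderiv ℝ H z v α) = - α (fderiv ℝ H z v β) := by
  have key : ∀ α β : E →L[ℝ] ℝ,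
      HasFDerivAt (fun z => β (H z α)) (β.comp ((fderiv ℝ H z).flip α)) z := fun α β => by
    have h1 := HasFDerivAt.clm_apply (G := E →L[ℝ] ℝ) hd.hasFDerivAt (hasFDerivAt_const α z)
    have h2 := β.hasFDerivAt.comp z h1
    refine h2.congr_fderiv ?_
    ext v
    simp
  have h1 := key α β
  have h2 := (key β α).neg
  have h3 : (fun z => β (H z α)) = -(fun z => α (H z β)) := funext fun z => hH z α β
  rw [h3] at h1
  exact congrArg (fun L : E →L[ℝ] ℝ => L v) (h1.unique h2)

variable [FiniteDimensional ℝ E]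

open Module in
/-- The rank of a Poisson structure does not increase along the integral curves of
a Hamiltonian vector field. -/
theorem eventually_rank_le_along_hamiltonian {H : E → (E →L[ℝ] ℝ) →L[ℝ] E}
    (hskew : ∀ (z : E) (α β : E →L[ℝ] ℝ), β (H z α) = - α (H z β)) {c : ℝ → E} {η : ℝ → E →L[ℝ] ℝ} {t₀ : ℝ}
    (hH : ContDiffAt ℝ ∞ H (c t₀)) (hHd : ∀ᶠ z in nhds (c t₀), DifferentiableAt ℝ H z)
    (hJ : ∀ᶠ z in nhds (c t₀), ∀ α β γ, schoutenForm H H z α β γ = 0)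
    (hc : ContDiffAt ℝ ∞ c t₀) (hη : ContDiffAt ℝ ∞ η t₀)
    (hd : ∀ᶠ t in nhds t₀, HasDerivAt c (H (c t) (η t)) t) :
    ∀ᶠ t in nhds t₀, finrank ℝ (LinearMap.range (H (c t)).toLinearMap) ≤
      finrank ℝ (LinearMap.range (H (c t₀)).toLinearMap) := by
  -- With `N v = dH(v) η`, the Jacobi identity on `(α, β, η)` says that the derivative of `H` along
  -- `H η` is `N H + H N*`. No derivative of `η` enters, so `η` may be any smooth curve of
  -- covectors.
  refine eventually_rank_le_of_hasDerivAt (fun t => H (c t))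
    (fun t => (fderiv ℝ H (c t)).flip (η t)) t₀ ?_ ?_
  · exact ContDiffAt.clm_apply (F := E →L[ℝ] ℝ)
      (((contDiffAt_fderiv_flip (X := E →L[ℝ] ℝ) (Y := E) hH).comp t₀ hc).of_le
        (by exact_mod_cast le_top)) (hη.of_le (by exact_mod_cast le_top))
  · filter_upwards [hd, hc.continuousAt.eventually hHd, hc.continuousAt.eventually hJ]
      with t ht hHt hJt
    have h1 := HasFDerivAt.comp_hasDerivAt (F := E) (E := (E →L[ℝ] ℝ) →L[ℝ] E) t
      hHt.hasFDerivAt ht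
    refine h1.congr_deriv ?_
    refine ContinuousLinearMap.ext fun α => ?_
    rw [← sub_eq_zero]
    refine (Module.forall_dual_apply_eq_zero_iff ℝ _).1 fun f => ?_
    set β := LinearMap.toContinuousLinearMap f
    change β _ = 0
    have h2 := hJt α β (η t)
    have h3 := fderiv_skew hskew hHt (H (c t) α) (η t) β
    have h4 := hskew (c t) (precompDual E ((fderiv ℝ H (c t)).flip (η t)) α) β
    simp only [precompDual_apply, ContinuousLinearMap.comp_apply,
      ContinuousLinearMap.flip_apply] at h4
    simp only [map_sub, map_add, add_apply, ContinuousLinearMap.comp_apply,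
      ContinuousLinearMap.flip_apply, precompDual_apply]
    rw [h4]
    unfold schoutenForm at h2
    rw [fderiv_skew hskew hHt (H (c t) α) β (η t)] at h2
    linarith

theorem exists_contDiff_eventuallyEq {X : Type*} [NormedAddCommGroup X] [NormedSpace ℝ X]
    {a : ℝ → X} {t₀ : ℝ} (ha : ∀ᶠ t in nhds t₀, ContDiffAt ℝ ∞ a t) :
    ∃ b : ℝ → X, ContDiff ℝ ∞ b ∧ HasCompactSupport b ∧ b =ᶠ[nhds t₀] a := by
  obtain ⟨r, hr, hball⟩ := Metric.eventually_nhds_iff_ball.1 ha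
  let θ : ContDiffBump t₀ := ⟨r / 4, r / 2, by linarith, by linarith⟩
  refine ⟨fun t => θ t • a t, ?_, θ.hasCompactSupport.smul_right, ?_⟩
  · rw [contDiff_iff_contDiffAt]
    intro t
    by_cases ht : t ∈ Metric.ball t₀ r
    · exact θ.contDiffAt.smul (hball t ht)
    · have h0 : (fun t => θ t • a t) =ᶠ[nhds t] fun _ => 0 := by
        have : t ∉ tsupport θ := fun hmem => ht <| by
          rw [θ.tsupport_eq] at hmem
          exact Metric.closedBall_subset_ball (by simp only [θ]; linarith) hmem
        filter_upwards [notMem_tsupport_iff_eventuallyEq.1 this] with s hs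
        simp [hs]
      exact contDiffAt_const.congr_of_eventuallyEq h0
  · filter_upwards [θ.eventuallyEq_one] with t ht
    simp [ht]

open Module in
/-- A curve in the range of `C t` lifts smoothly if the rank of `C t` is maximal at `t₀`. -/
theorem exists_lift_of_finrank_le {X : Type*} [NormedAddCommGroup X] [NormedSpace ℝ X]
    [FiniteDimensional ℝ X] {C : ℝ → X →L[ℝ] E} {u : ℝ → E} {t₀ : ℝ} (R : ℝ → Submodule ℝ E)
    (hC : ∀ᶠ t in nhds t₀, ContDiffAt ℝ ∞ C t) (hu : ∀ᶠ t in nhds t₀, ContDiffAt ℝ ∞ u t)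
    (hR : ∀ᶠ t in nhds t₀, LinearMap.range (C t).toLinearMap ≤ R t)
    (hr : ∀ᶠ t in nhds t₀, finrank ℝ (R t) ≤ finrank ℝ (LinearMap.range (C t₀).toLinearMap))
    (huR : ∀ᶠ t in nhds t₀, u t ∈ R t) :
    ∃ a : ℝ → X, ContDiff ℝ ∞ a ∧ HasCompactSupport a ∧ ∀ᶠ t in nhds t₀, C t (a t) = u t := by
  have : CompleteSpace E := FiniteDimensional.complete ℝ E
  obtain ⟨G, hG⟩ := (C t₀).toLinearMap.exists_generalized_inverse
  set Gc : E →L[ℝ] X := LinearMap.toContinuousLinearMap G with hGc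
  obtain ⟨N, hN, -, hNC⟩ := exists_leftInverse_near C t₀ hC Gc
  -- `G N` inverts `C t` on `R t` near `t₀`; a cutoff in time extends the resulting lift to all of
  -- `ℝ`.
  obtain ⟨b, hb, hbc, hba⟩ := exists_contDiff_eventuallyEq (a := fun t => Gc (N t (u t))) (by
    filter_upwards [hN, hu] with t hNt hut
    exact Gc.contDiff.contDiffAt.comp t (hNt.clm_apply hut))
  refine ⟨b, hb, hbc, ?_⟩
  filter_upwards [hba, hNC, hR, hr, huR] with t h1 h2 h3 h4 h5
  rw [h1]
  exact (LinearMap.rightInverse_of_finrank_le (C t₀).toLinearMap (C t).toLinearMap G hG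
    (N t).toLinearMap h2 (R t) h3 h4 (u t) h5).1

end LiftingCurves

section Leaves

variable {E : Type*} [NormedAddCommGroup E] [NormedSpace ℝ E] [FiniteDimensional ℝ E]
  {S : Type*} [TopologicalSpace S] [T2Space S]
  [ChartedSpace E S] [IsManifold 𝓘(ℝ, E) ∞ S]
  {F : Type*} [NormedAddCommGroup F] [NormedSpace ℝ F] [FiniteDimensional ℝ F]
  {M : Type*} [TopologicalSpace M] [T2Space M] [ChartedSpace F M] [IsManifold 𝓘(ℝ, F) ∞ M]
  {πS πV : BivectorField E S} {πM : BivectorField F M} {p : S → M}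

omit [T2Space S] [T2Space M] in
-- Pointwise source of the lift: covectors pulled back from the base already produce every value of
-- the horizontal part.
theorem IsVerticalPartField.exists_pullback_sharp_eq (h : IsVerticalPartField F πS p πV)
    (hp : IsPoissonSubmersion πS πM p) (hcor : HasCoregularFibres F πS p) (x : S)
    (η : CotangentAt E x) :
    ∃ c : CotangentAt F (p x), (πS.sub πV).sharp x η =
      (πS.sub πV).sharp x (c.comp (mfderiv 𝓘(ℝ, E) 𝓘(ℝ, F) p x)) := by
  obtain ⟨b, hb, hηb⟩ := (h x).exists_sub_apply_eq (πS.skew x) (hcor.apply_eq_zero x) η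
  obtain ⟨c, rfl⟩ := exists_pullback_eq hp x b hb
  refine ⟨c, hηb.trans ?_⟩
  rw [BivectorField.sub_sharp_apply, (h x).eq_zero _ hb, sub_zero]

/-- Along a Hamiltonian curve of the horizontal part, the Hamiltonian vector fields of
pulled back functions suffice. -/
theorem IsVerticalPartField.exists_local_hamiltonian (h : IsVerticalPartField F πS p πV)
    (hp : IsPoissonSubmersion πS πM p) (hcor : HasCoregularFibres F πS p)
    (hH : (πS.sub πV).IsPoisson) {g : S × ℝ → ℝ}
    (hg : ContMDiff (𝓘(ℝ, E).prod 𝓘(ℝ, ℝ)) 𝓘(ℝ, ℝ) ∞ g) {γ : ℝ → S} {I : Set ℝ}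
    (hγ : ∀ t ∈ I, HasMFDerivWithinAt 𝓘(ℝ, ℝ) 𝓘(ℝ, E) γ I t ((1 : ℝ →L[ℝ] ℝ).smulRight
      ((πS.sub πV).hamiltonian (fun y => g (y, t)) (γ t))))
    {τ : ℝ → ℝ} (hτ : ContDiff ℝ ∞ τ) (hτI : ∀ t, τ t ∈ I) (t₁ : ℝ) :
    ∃ f : M × ℝ → ℝ, ContMDiff (𝓘(ℝ, F).prod 𝓘(ℝ, ℝ)) 𝓘(ℝ, ℝ) ∞ f ∧ HasCompactSupport f ∧
      ∀ᶠ t in nhds t₁, πS.hamiltonian (fun y => f (p y, t)) (γ (τ t)) =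
        deriv τ t • (πS.sub πV).hamiltonian (fun y => g (y, τ t)) (γ (τ t)) := by
  set x₁ := γ (τ t₁) with hx₁
  set H := chartRep x₁ (πS.sub πV).sharp with hHdef
  set c : ℝ → E := fun t => extChartAt 𝓘(ℝ, E) x₁ (γ (τ t)) with hcdef
  set η : ℝ → E →L[ℝ] ℝ := fun t => deriv τ t • chartDifferential g x₁ (τ t) (c t) with hηdef
  have hcont : Continuous fun t => γ (τ t) := by
    have h1 : ContinuousOn γ I := fun t ht => (hγ t ht).continuousWithinAt
    exact h1.comp_continuous hτ.continuous hτI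
  have hx₁s : γ (τ t₁) ∈ (chartAt E x₁).source := mem_chart_source E x₁
  have hsrc : ∀ᶠ t in nhds t₁, γ (τ t) ∈ (chartAt E x₁).source :=
    hcont.continuousAt ((chartAt E x₁).open_source.mem_nhds hx₁s)
  have hcs : ∀ t, γ (τ t) ∈ (chartAt E x₁).source → ContDiffAt ℝ ∞ c t := fun t ht => by
    rw [← contDiffWithinAt_univ]
    exact (contDiffWithinAt_chart_of_hamiltonian _ hg hγ (hτI t) ht).comp t
      hτ.contDiffAt.contDiffWithinAt fun t _ => hτI t
  have hτ' : ContDiff ℝ ∞ (deriv τ) := hτ.deriv'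
  have hηs : ∀ t, γ (τ t) ∈ (chartAt E x₁).source → ContDiffAt ℝ ∞ η t := fun t ht => by
    have hz := (extChartAt 𝓘(ℝ, E) x₁).map_source (x := γ (τ t)) (by simpa using ht)
    exact hτ'.contDiffAt.smul ((contDiffAt_chartDifferential hg hz (τ t)).comp
      (f := fun t => (τ t, c t)) t (hτ.contDiffAt.prodMk (hcs t ht)))
  have hcd : ∀ t, γ (τ t) ∈ (chartAt E x₁).source → HasDerivAt c (H (c t) (η t)) t := fun t ht => by
    have h1 := (hγ (τ t) (hτI t)).hasDerivWithinAt_chart ht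
    -- All values of `τ` lie in `I`, so the derivative within `I` becomes a two-sided derivative of
    -- the reparametrized curve.
    have h2 := h1.scomp_hasDerivAt t (hτ.differentiable (by simp) t).hasDerivAt hτI
    rw [BivectorField.chartDeriv_hamiltonian _ hg ht] at h2
    rw [hηdef, map_smul]
    exact h2
  have htarget := extChartAt_target_mem_nhds_image hx₁s
  have hrank := eventually_rank_le_along_hamiltonian (H := H) (c := c) (η := η) (t₀ := t₁)
    (πS.sub πV).chartRep_skew ((πS.sub πV).contDiffAt_chartRep hx₁s)
    (by
      filter_upwards [htarget] with z hz
      exact ((πS.sub πV).contDiffAt_chartRep_of_mem_target hz).differentiableAt (by simp))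
    (by
      filter_upwards [htarget] with z hz α β δ
      have := hH.schoutenForm_eq_zero (chart_symm_mem_source hz) α β δ
      rwa [(extChartAt 𝓘(ℝ, E) x₁).right_inv hz] at this)
    (hcs t₁ hx₁s) (hηs t₁ hx₁s) (hsrc.mono hcd)
  obtain ⟨Ψ, hΨ, hΨc, hΨm⟩ := exists_compactlySupported_chart F (p x₁)
  set Q : E → F := (Ψ ∘ p) ∘ (extChartAt 𝓘(ℝ, E) x₁).symm with hQdef
  have hQ : ∀ t, γ (τ t) ∈ (chartAt E x₁).source → ContDiffAt ℝ ∞ Q (c t) := fun t ht =>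
    (contMDiffAt_iff_chart ht _).1 ((hΨ.comp hp.smooth) _)
  set P : (E →L[ℝ] F) →L[ℝ] (F →L[ℝ] ℝ) →L[ℝ] (E →L[ℝ] ℝ) :=
    (ContinuousLinearMap.compL ℝ E F ℝ).flip with hPdef
  have hP : ContDiff ℝ ∞ P := by fun_prop
  have hHs : ∀ t, γ (τ t) ∈ (chartAt E x₁).source → ContDiffAt ℝ ∞ (fun t => H (c t)) t :=
    fun t ht => by
      have h1 : ContDiffAt ℝ ∞ H (c t) := (πS.sub πV).contDiffAt_chartRep ht
      exact ContDiffAt.comp (F := E) (G := (E →L[ℝ] ℝ) →L[ℝ] E) (g := H) t h1 (hcs t ht)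
  set C : ℝ → (F →L[ℝ] ℝ) →L[ℝ] E := fun t => (H (c t)).comp (P (fderiv ℝ Q (c t))) with hCdef
  have hCs : ∀ t, γ (τ t) ∈ (chartAt E x₁).source → ContDiffAt ℝ ∞ C t := fun t ht => by
    have h1 := hHs t ht
    have h2 : ContDiffAt ℝ ∞ (fun t => fderiv ℝ Q (c t)) t :=
      ((hQ t ht).fderiv_right (m := ∞) (by simp)).comp t (hcs t ht)
    exact h1.clm_comp (hP.contDiffAt.comp t h2)
  -- `C t` is `H (c t)` restricted to pulled-back covectors. At `t₁` it loses no rank, and nearby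
  -- the rank of `H (c t)` is no larger, which is what the lifting lemma needs.
  have hrange : LinearMap.range (H (c t₁)).toLinearMap ≤ LinearMap.range (C t₁).toLinearMap := by
    rintro _ ⟨α, rfl⟩
    obtain ⟨b, hb⟩ := h.exists_pullback_sharp_eq hp hcor x₁ (α.comp (chartDeriv E x₁ x₁))
    refine ⟨b.comp (chartDerivSymm F (p x₁) (p x₁)), ?_⟩
    have h1 := mvfderiv_eq_fderiv_comp_chartDeriv hx₁s (Ψ ∘ p) ((hΨ.comp hp.smooth) _)
    have h2 := mvfderiv_comp_submersion hp hΨ x₁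
    rw [mvfderiv_comp_chart hΨm] at h2
    change H (c t₁) ((b.comp (chartDerivSymm F (p x₁) (p x₁))).comp (fderiv ℝ Q (c t₁))) =
      H (c t₁) α
    have h3 : ∀ α, H (c t₁) α = _ := fun α => chartRep_chart_apply (πS.sub πV).sharp hx₁s α
    rw [h3, h3]
    change chartDeriv E x₁ x₁ _ = chartDeriv E x₁ x₁ _
    rw [hb]
    congr 2
    rw [ContinuousLinearMap.comp_assoc, ← h1, h2, ← ContinuousLinearMap.comp_assoc,
      comp_chartDerivSymm_comp_chartDeriv (mem_chart_source F (p x₁))]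
  obtain ⟨a, ha, hac, haC⟩ := exists_lift_of_finrank_le (C := C) (t₀ := t₁)
    (u := fun t => H (c t) (η t)) (fun t => LinearMap.range (H (c t)).toLinearMap)
    (hsrc.mono hCs)
    (hsrc.mono fun t ht => ContDiffAt.clm_apply (F := E →L[ℝ] ℝ) (hHs t ht) (hηs t ht))
    (Filter.Eventually.of_forall fun t => by rintro _ ⟨β, rfl⟩; exact ⟨_, rfl⟩)
    (hrank.mono fun t ht => ht.trans (Submodule.finrank_mono hrange))
    (Filter.Eventually.of_forall fun t => ⟨_, rfl⟩)
  -- The lifted covector `a t` is used as a linear function of the cut-off chart `Ψ` on the base;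
  -- compact support comes from `Ψ` in space and from `a` in time.
  have hf : ContMDiff (𝓘(ℝ, F).prod 𝓘(ℝ, ℝ)) 𝓘(ℝ, ℝ) ∞ (fun q : M × ℝ => a q.2 (Ψ q.1)) :=
    (ha.contMDiff.comp contMDiff_snd).clm_apply (hΨ.comp contMDiff_fst)
  refine ⟨fun q => a q.2 (Ψ q.1), hf, ?_, ?_⟩
  · refine HasCompactSupport.intro (hΨc.isCompact.prod hac.isCompact) fun q hq => ?_
    by_cases h1 : q.1 ∈ tsupport Ψ
    · have h2 : q.2 ∉ tsupport a := fun h2 => hq ⟨h1, h2⟩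
      simp [image_eq_zero_of_notMem_tsupport h2]
    · simp [image_eq_zero_of_notMem_tsupport h1]
  · filter_upwards [haC, hsrc] with t hat ht
    have hft : ContMDiff 𝓘(ℝ, F) 𝓘(ℝ, ℝ) ∞ (fun m => a t (Ψ m)) := contMDiff_slice hf t
    have h1 : πS.hamiltonian (fun y => a t (Ψ (p y))) (γ (τ t)) =
        (πS.sub πV).hamiltonian ((fun m => a t (Ψ m)) ∘ p) (γ (τ t)) :=
      (h.sub_hamiltonian hp hft _).symm
    have h2 : chartDeriv E x₁ (γ (τ t))
        ((πS.sub πV).hamiltonian ((fun m => a t (Ψ m)) ∘ p) (γ (τ t))) = C t (a t) := by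
      rw [BivectorField.hamiltonian,
        mvfderiv_eq_fderiv_comp_chartDeriv ht _ ((hft.comp hp.smooth) _),
        ← chartRep_chart_apply _ ht]
      have h3 := ((a t).hasFDerivAt.comp (c t)
        ((hQ t ht).differentiableAt (by simp)).hasFDerivAt).fderiv
      change H (c t) (fderiv ℝ (a t ∘ Q) (c t)) = _
      rw [h3]
      rfl
    change πS.hamiltonian (fun y => a t (Ψ (p y))) (γ (τ t)) = _
    rw [h1, ← chartDerivSymm_chartDeriv ht ((πS.sub πV).hamiltonian _ _), h2, hat, hηdef]
    simp only [map_smul]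
    rw [hHdef, hcdef, ← BivectorField.chartDeriv_hamiltonian _ hg ht, chartDerivSymm_chartDeriv ht]

end Leaves

theorem BivectorField.hamiltonian_sum {E : Type*} [NormedAddCommGroup E] [NormedSpace ℝ E]
    {S : Type*} [TopologicalSpace S] [ChartedSpace E S] [IsManifold 𝓘(ℝ, E) ∞ S]
    (π : BivectorField E S) {ι : Type*} [Fintype ι] (r : ι → ℝ) {f : ι → S → ℝ}
    (hf : ∀ i, ContMDiff 𝓘(ℝ, E) 𝓘(ℝ, ℝ) ∞ (f i)) (x : S) :
    π.hamiltonian (fun y => ∑ i, r i • f i y) x = ∑ i, r i • π.hamiltonian (f i) x := by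
  have hx := mem_chart_source E x
  have hsum : ContMDiff 𝓘(ℝ, E) 𝓘(ℝ, ℝ) ∞ (fun y => ∑ i, r i • f i y) :=
    contMDiff_finsetSum fun i _ => by
      have h0 : ContMDiff 𝓘(ℝ, E) 𝓘(ℝ, ℝ) ∞ (fun _ : S => r i) := contMDiff_const
      exact h0.smul (hf i)
  simp only [hamiltonian]
  rw [mvfderiv_eq_fderiv_comp_chartDeriv hx _ (hsum x)]
  have h1 : ∀ i, mvfderiv 𝓘(ℝ, E) (f i) x = _ := fun i =>
    mvfderiv_eq_fderiv_comp_chartDeriv hx (f i) (hf i x)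
  have hd : ∀ i, HasFDerivAt (f i ∘ (extChartAt 𝓘(ℝ, E) x).symm) _ (extChartAt 𝓘(ℝ, E) x x) :=
    fun i => (((contMDiffAt_iff_chart hx (f i)).1 (hf i x)).differentiableAt (by simp)).hasFDerivAt
  have h2 := (HasFDerivAt.fun_sum (u := Finset.univ) fun i _ => (hd i).const_smul (r i)).fderiv
  change π.sharp x ((fderiv ℝ (fun z => ∑ i, r i • (f i ∘ (extChartAt 𝓘(ℝ, E) x).symm) z) _).comp _) = _
  simp only [Pi.smul_apply] at h2
  rw [h2]
  simp only [h1, ContinuousLinearMap.finsetSum_comp, map_sum, ContinuousLinearMap.smul_comp,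
    map_smul]

section Leaves

variable {E : Type*} [NormedAddCommGroup E] [NormedSpace ℝ E] [FiniteDimensional ℝ E]
  {S : Type*} [TopologicalSpace S] [T2Space S]
  [ChartedSpace E S] [IsManifold 𝓘(ℝ, E) ∞ S]
  {F : Type*} [NormedAddCommGroup F] [NormedSpace ℝ F] [FiniteDimensional ℝ F]
  {M : Type*} [TopologicalSpace M] [T2Space M] [ChartedSpace F M] [IsManifold 𝓘(ℝ, F) ∞ M]
  {πS πV : BivectorField E S} {πM : BivectorField F M} {p : S → M}

omit [FiniteDimensional ℝ E] [T2Space S] [FiniteDimensional ℝ F]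
  [IsManifold 𝓘(ℝ, F) ∞ M] in
/-- Time-dependent functions, prescribed locally in time, are glued by a partition of unity. -/
theorem BivectorField.exists_hamiltonian_of_local (π : BivectorField E S) {p : S → M}
    (hp : ContMDiff 𝓘(ℝ, E) 𝓘(ℝ, F) ∞ p) (γ : ℝ → S) (X : ∀ t, TangentSpace 𝓘(ℝ, E) (γ t))
    {K : Set ℝ} (hK : IsCompact K)
    (hloc : ∀ t₁ ∈ K, ∃ f : M × ℝ → ℝ, ContMDiff (𝓘(ℝ, F).prod 𝓘(ℝ, ℝ)) 𝓘(ℝ, ℝ) ∞ f ∧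
      HasCompactSupport f ∧ ∀ᶠ t in nhds t₁, π.hamiltonian (fun y => f (p y, t)) (γ t) = X t) :
    ∃ f : M × ℝ → ℝ, ContMDiff (𝓘(ℝ, F).prod 𝓘(ℝ, ℝ)) 𝓘(ℝ, ℝ) ∞ f ∧
      HasCompactSupport f ∧ ∀ t ∈ K, π.hamiltonian (fun y => f (p y, t)) (γ t) = X t := by
  choose! f hf hfc hfX using hloc
  have hU : ∀ t₁ ∈ K, ∃ U : Set ℝ, IsOpen U ∧ t₁ ∈ U ∧
      ∀ t ∈ U, π.hamiltonian (fun y => f t₁ (p y, t)) (γ t) = X t := fun t₁ ht₁ => by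
    obtain ⟨U, hU, hUo, hUm⟩ := eventually_nhds_iff.1 (hfX t₁ ht₁)
    exact ⟨U, hUo, hUm, hU⟩
  choose! U hUo hUm hUX using hU
  obtain ⟨s, hs⟩ := hK.elim_finite_subcover (fun t : K => U t) (fun t => hUo t t.2)
    fun t ht => Set.mem_iUnion.2 ⟨⟨t, ht⟩, hUm t ht⟩
  obtain ⟨ρ, hρ⟩ := SmoothPartitionOfUnity.exists_isSubordinate 𝓘(ℝ, ℝ) hK.isClosed
    (fun i : s => U (i : K)) (fun i => hUo _ i.1.2) fun t ht => by
      obtain ⟨i, hi, hti⟩ := Set.mem_iUnion₂.1 (hs ht)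
      exact Set.mem_iUnion.2 ⟨⟨i, hi⟩, hti⟩
  refine ⟨fun q => ∑ i : s, ρ i q.2 • f (i : K) q, ?_, ?_, fun t ht => ?_⟩
  · exact contMDiff_finsetSum fun i _ =>
      ((ρ i).contMDiff.comp contMDiff_snd).smul (hf _ i.1.2)
  · refine HasCompactSupport.intro (isCompact_iUnion fun i : s => (hfc (i : K) i.1.2).isCompact)
      fun q hq => Finset.sum_eq_zero fun i _ => ?_
    have : q ∉ tsupport (f (i : K)) := fun hmem => hq (Set.mem_iUnion.2 ⟨i, hmem⟩)
    rw [image_eq_zero_of_notMem_tsupport this, smul_zero]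
  · have h1 := π.hamiltonian_sum (fun i : s => ρ i t) (f := fun i y => f (i : K) (p y, t))
      (fun i => (contMDiff_slice (hf _ i.1.2) t).comp hp) (γ t)
    have h2 : ∀ i : s, ρ i t • π.hamiltonian (fun y => f (i : K) (p y, t)) (γ t) =
        ρ i t • X t := fun i => by
      by_cases hi : t ∈ U (i : K)
      · rw [hUX _ i.1.2 t hi]
      · rw [image_eq_zero_of_notMem_tsupport fun hmem => hi (hρ i hmem), zero_smul, zero_smul]
    have h3 := ρ.sum_eq_one ht
    rw [finsum_eq_sum_of_fintype] at h3
    simp only [h2] at h1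
    rw [← Finset.sum_smul, h3, one_smul] at h1
    exact h1

theorem IsVerticalPartField.leaf_subset_horizontalLeaf (h : IsVerticalPartField F πS p πV)
    (hp : IsPoissonSubmersion πS πM p) (hcor : HasCoregularFibres F πS p)
    (hH : (πS.sub πV).IsPoisson) (x : S) :
    (πS.sub πV).leaf x ⊆ horizontalLeaf F πS p x := by
  rintro x₁ ⟨g, hg, -, γ, h0, h1, hγ⟩
  -- This reparametrization keeps both endpoints and maps all of `ℝ` into `[0, 1]`, so lifts exist
  -- on full neighbourhoods of the times 0 and 1 as well.
  have hτ : ContDiff ℝ ∞ Real.smoothTransition := Real.smoothTransition.contDiff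
  have hτI : ∀ t, Real.smoothTransition t ∈ Set.Icc (0 : ℝ) 1 := fun t =>
    ⟨Real.smoothTransition.nonneg t, Real.smoothTransition.le_one t⟩
  obtain ⟨f, hf, hfc, hfX⟩ := πS.exists_hamiltonian_of_local hp.smooth
    (fun t => γ (Real.smoothTransition t)) (fun t => deriv Real.smoothTransition t •
      (πS.sub πV).hamiltonian (fun y => g (y, Real.smoothTransition t))
        (γ (Real.smoothTransition t))) (isCompact_Icc (a := (0 : ℝ)) (b := 1))
    fun t _ => h.exists_local_hamiltonian hp hcor hH hg hγ hτ hτI t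
  refine ⟨f, hf, hfc, fun t => γ (Real.smoothTransition t), ?_, ?_, fun t ht => ?_⟩
  · simp [h0]
  · simp [h1]
  · have h2 : HasMFDerivWithinAt 𝓘(ℝ, ℝ) 𝓘(ℝ, ℝ) Real.smoothTransition (Set.Icc 0 1) t
        ((1 : ℝ →L[ℝ] ℝ).smulRight (deriv Real.smoothTransition t)) :=
      ((hτ.differentiable (by simp) t).hasDerivAt.hasFDerivAt.hasFDerivWithinAt).hasMFDerivWithinAt
    have h3 := (hγ _ (hτI t)).comp t h2 fun t _ => hτI t
    rw [hfX t ht]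
    refine h3.congr_mfderiv ?_
    refine ContinuousLinearMap.ext_ring ?_
    change ((1 : ℝ) • deriv Real.smoothTransition t) •
      (πS.sub πV).hamiltonian _ (γ (Real.smoothTransition t)) = (1 : ℝ) • _
    rw [one_smul, one_smul]
    rfl

theorem IsVerticalPartField.hasHorizontalLeaves [SecondCountableTopology S]
    (h : IsVerticalPartField F πS p πV) (hp : IsPoissonSubmersion πS πM p)
    (hcor : HasCoregularFibres F πS p) (hH : (πS.sub πV).IsPoisson) :
    HasHorizontalLeaves F πS p (πS.sub πV) := fun x =>
  ⟨Set.Subset.antisymm (h.leaf_subset_horizontalLeaf hp hcor hH x)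
    (h.horizontalLeaf_subset_leaf hp x), h.image_sub hcor x,
    fun u hu v hv => h.leafForm_sub x u v hu hv⟩

end Leaves

/-! ### The four conditions, each equivalent to smoothness of the vertical part -/

theorem mainTheorem3
    {E : Type*} [NormedAddCommGroup E] [NormedSpace ℝ E] [FiniteDimensional ℝ E]
    {S : Type*} [TopologicalSpace S] [T2Space S] [SecondCountableTopology S]
    [ChartedSpace E S] [IsManifold 𝓘(ℝ, E) ∞ S]
    {F : Type*} [NormedAddCommGroup F] [NormedSpace ℝ F] [FiniteDimensional ℝ F]
    {M : Type*} [TopologicalSpace M] [T2Space M] [SecondCountableTopology M]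
    [ChartedSpace F M] [IsManifold 𝓘(ℝ, F) ∞ M]
    (πS : BivectorField E S) (hS : πS.IsPoisson)
    (πM : BivectorField F M) (hM : πM.IsPoisson)
    (p : S → M) (hp : IsPoissonSubmersion πS πM p)
    (hcor : HasCoregularFibres F πS p) :
    List.TFAE [
      IsOrthogonalPencil F πS p,
      ∃ πH : BivectorField E S, πH.IsPoisson ∧ HasHorizontalLeaves F πS p πH,
      ∃ πV : BivectorField E S, πV.IsPoisson ∧ IsVertical F πV p ∧
        FibrePoissonAssembleTo F πS p πV,
      VerticalDiracFamilyIsBundle F πS p] := by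
  have h1 : IsOrthogonalPencil F πS p ↔ ∃ πV, IsVerticalPartField F πS p πV :=
    ⟨fun h => h.exists_isVerticalPartField, fun ⟨πV, h⟩ =>
      ⟨πV, πS.sub πV, h.isPoisson hp hcor hS, h.isPoisson_sub hp hcor hS,
        h.commute_sub hp hcor hS, fun x => by
          ext α
          rw [add_apply, BivectorField.sub_sharp_apply, add_sub_cancel],
        h.isVertical hcor, h.image_sub_inf_eq_bot hcor⟩⟩
  have h2 : (∃ πH : BivectorField E S, πH.IsPoisson ∧ HasHorizontalLeaves F πS p πH) ↔
      ∃ πV, IsVerticalPartField F πS p πV :=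
    ⟨fun ⟨πH, _, h⟩ => ⟨_, h.isVerticalPartField⟩, fun ⟨πV, h⟩ =>
      ⟨πS.sub πV, h.isPoisson_sub hp hcor hS,
        h.hasHorizontalLeaves hp hcor (h.isPoisson_sub hp hcor hS)⟩⟩
  have h3 : (∃ πV : BivectorField E S, πV.IsPoisson ∧ IsVertical F πV p ∧
      FibrePoissonAssembleTo F πS p πV) ↔ ∃ πV, IsVerticalPartField F πS p πV :=
    ⟨fun ⟨πV, _, _, h⟩ => ⟨πV, h.isVerticalPartField⟩, fun ⟨πV, h⟩ =>
      ⟨πV, h.isPoisson hp hcor hS, h.isVertical hcor, h.fibrePoissonAssembleTo hcor⟩⟩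
  have h4 : VerticalDiracFamilyIsBundle F πS p ↔ ∃ πV, IsVerticalPartField F πS p πV :=
    ⟨fun h => h.exists_isVerticalPartField hcor, fun ⟨πV, h⟩ =>
      h.verticalDiracFamilyIsBundle hcor⟩
  rw [h1, h2, h3, h4]
  tfae_finish
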